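/- Let $\alpha,\beta>0$, let $A,B$ be real numbers with $A\ge 0$, $A+B\ge 0$, not both $A$ and $A+B$ equal to zero, and let $n\ge 0$ be an integer. For $0\le t<1$ consider the weight on $[0,1]$ $$w(x)=w(x;t)=x^{\alpha}(1-x)^{\beta}\bigl(A+B\,\theta(x-t)\bigr),$$ where $\theta$ is the Heaviside step function. Let $P_k(x)=P_k(x;t)$, $k\ge 0$, be the monic polynomials orthogonal with respect to $w$, let $h_k(t)=\int_0^1 P_k(x)^2w(x)\,dx$, and put $$x_n(t)=\frac{\beta}{h_n(t)}\int_0^1\frac{P_n(y)^2}{1-y}\,w(y)\,dy .$$ Define $W_n$ on $[0,1)$ by $$x_n(t)=(2n+1+\alpha+\beta)\,\frac{1-W_n(t)}{1-t}.$$ Then $W_n$ is twice continuously differentiable on $(0,1)$. For $t\in(0,1)$ one has $W_n(t)=t$ if and only if $B\,P_n(t;t)=0$. At every other point $t\in(0,1)$ also $W_n(t)\ne 0$ and $W_n(t)\neq 1$, and $W_n$ satisfies the Painlevé VI equation $$W_n''=\frac12\Bigl(\frac1{W_n}+\frac1{W_n-1}+\frac1{W_n-t}\Bigr)(W_n')^2-\Bigl(\frac1t+\frac1{t-1}+\frac1{W_n-t}\Bigr)W_n'+\frac{W_n(W_n-1)(W_n-t)}{t^2(t-1)^2}\Bigl(a+\frac{b\,t}{W_n^2}+\frac{c\,(t-1)}{(W_n-1)^2}+\frac{d\,t(t-1)}{(W_n-t)^2}\Bigr)$$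 with $$a=\frac{(2n+\alpha+\beta+1)^2}{2},\qquad b=-\frac{\alpha^2}{2},\qquad c=\frac{\beta^2}{2},\qquad d=\frac12 .$$ If moreover $A+B>0$ (so that the weight does not vanish identically at $t=0$), then $W_n(0)=0$ and $W_n'(0)=1$, the latter being the right-hand derivative at $0$. -/

import Mathlib

open Set
open scoped Polynomial

noncomputable section

namespace PerturbedJacobi

/-- The Heaviside step function (its value at the jump plays no role). -/
def heaviside (s : ℝ) : ℝ := if 0 ≤ s then 1 else 0

/-- The perturbed Jacobi weight `x^α (1-x)^β (A + B θ(x-t))` on `[0,1]`. -/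
def weight (α β A B t x : ℝ) : ℝ :=
  x ^ α * (1 - x) ^ β * (A + B * heaviside (x - t))

/-- Integration of a polynomial against the weight. -/
def functional (α β A B t : ℝ) (p : ℝ[X]) : ℝ :=
  ∫ x in (0 : ℝ)..1, p.eval x * weight α β A B t x

/-- The monic polynomials orthogonal with respect to the weight, obtained from
`1, x, x², …` by the Gram–Schmidt process. See `functional_orthoPoly_mul` and
`functional_orthoPoly_sq_pos` below for the orthogonality relations. -/
def orthoPoly (α β A B t : ℝ) : ℕ → ℝ[X]
  | n => Polynomial.X ^ n - ∑ k : Fin n,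
      Polynomial.C (functional α β A B t (Polynomial.X ^ n * orthoPoly α β A B t k.1) /
        functional α β A B t (orthoPoly α β A B t k.1 ^ 2)) * orthoPoly α β A B t k.1
  termination_by n => n
  decreasing_by all_goals exact k.2

/-- `h_n(t) = ∫₀¹ P_n(x;t)² w(x;t) dx`. -/
def normSq (α β A B : ℝ) (n : ℕ) (t : ℝ) : ℝ :=
  functional α β A B t (orthoPoly α β A B t n ^ 2)

/-- `x_n(t) = (β / h_n(t)) ∫₀¹ P_n(y;t)² / (1-y) w(y;t) dy`. -/
def auxX (α β A B : ℝ) (n : ℕ) (t : ℝ) : ℝ :=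
  β / normSq α β A B n t *
    ∫ y in (0 : ℝ)..1, (orthoPoly α β A B t n).eval y ^ 2 / (1 - y) * weight α β A B t y

/-- The sixth Painlevé equation with parameters `a, b, c, d` holds for `W` at the point `t`;
in particular none of the denominators in the equation vanishes there. -/
def PainleveVIAt (a b c d : ℝ) (W : ℝ → ℝ) (t : ℝ) : Prop :=
  (t ≠ 0 ∧ t ≠ 1 ∧ W t ≠ 0 ∧ W t ≠ 1 ∧ W t ≠ t) ∧
  deriv (deriv W) t =
    1 / 2 * (1 / W t + 1 / (W t - 1) + 1 / (W t - t)) * deriv W t ^ 2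
      - (1 / t + 1 / (t - 1) + 1 / (W t - t)) * deriv W t
      + W t * (W t - 1) * (W t - t) / (t ^ 2 * (t - 1) ^ 2) *
        (a + b * t / W t ^ 2 + c * (t - 1) / (W t - 1) ^ 2
          + d * t * (t - 1) / (W t - t) ^ 2)

lemma orthoPoly_eq (α β A B t : ℝ) (n : ℕ) :
    orthoPoly α β A B t n = Polynomial.X ^ n - ∑ k : Fin n,
      Polynomial.C (functional α β A B t (Polynomial.X ^ n * orthoPoly α β A B t k.1) /
        functional α β A B t (orthoPoly α β A B t k.1 ^ 2)) * orthoPoly α β A B t k.1 := by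
  rw [orthoPoly]

/-- `P_n` is monic of degree `n`. -/
lemma orthoPoly_monic_natDegree (α β A B t : ℝ) (n : ℕ) :
    (orthoPoly α β A B t n).Monic ∧ (orthoPoly α β A B t n).natDegree = n := by
  induction n using Nat.strong_induction_on with
  | _ n ih =>
    have hlt : (∑ k : Fin n,
      Polynomial.C (functional α β A B t (Polynomial.X ^ n * orthoPoly α β A B t k.1) /
        functional α β A B t (orthoPoly α β A B t k.1 ^ 2)) *
          orthoPoly α β A B t k.1).degree < (n : WithBot ℕ) := by
      refine (Polynomial.degree_sum_le _ _).trans_lt ?_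
      refine (Finset.sup_lt_iff (WithBot.bot_lt_coe n)).2 ?_
      intro k _
      rw [← Polynomial.smul_eq_C_mul]
      refine (Polynomial.degree_smul_le _ _).trans_lt ?_
      rw [Polynomial.degree_eq_natDegree (ih k.1 k.2).1.ne_zero, (ih k.1 k.2).2]
      exact WithBot.coe_lt_coe.2 (Nat.cast_lt.2 k.2)
    rw [orthoPoly_eq]
    refine ⟨Polynomial.monic_X_pow_sub hlt, ?_⟩
    refine Polynomial.natDegree_eq_of_degree_eq_some ?_
    rw [Polynomial.degree_sub_eq_left_of_degree_lt (by rwa [Polynomial.degree_X_pow]),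
      Polynomial.degree_X_pow]

lemma heaviside_mono : Monotone heaviside := by
  intro a b hab
  unfold heaviside
  split_ifs with h1 h2 <;> first | (exfalso; linarith) | norm_num

lemma integrable_mul_weight {α β : ℝ} (hα : 0 < α) (hβ : 0 < β) (A B t : ℝ) (p : ℝ[X]) :
    IntervalIntegrable (fun x => p.eval x * weight α β A B t x) MeasureTheory.volume 0 1 := by
  have hm : Monotone (fun x : ℝ => heaviside (x - t)) := fun a b hab =>
    heaviside_mono (by linarith)
  have h1 : IntervalIntegrable (fun x : ℝ => A + B * heaviside (x - t))
      MeasureTheory.volume 0 1 :=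
    intervalIntegrable_const.add (hm.intervalIntegrable.const_mul B)
  have hc : Continuous (fun x : ℝ => p.eval x * (x ^ α * (1 - x) ^ β)) := by
    refine p.continuous.mul ((Real.continuous_rpow_const hα.le).mul ?_)
    exact (Real.continuous_rpow_const hβ.le).comp (continuous_const.sub continuous_id)
  have h2 := h1.continuousOn_mul hc.continuousOn
  refine h2.congr (fun x _ => ?_)
  simp only [weight]
  ring

lemma functional_sub {α β : ℝ} (hα : 0 < α) (hβ : 0 < β) (A B t : ℝ) (p q : ℝ[X]) :
    functional α β A B t (p - q) = functional α β A B t p - functional α β A B t q := by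
  unfold functional
  rw [← intervalIntegral.integral_sub (integrable_mul_weight hα hβ A B t p)
    (integrable_mul_weight hα hβ A B t q)]
  congr 1
  ext x
  rw [Polynomial.eval_sub]
  ring

lemma functional_C_mul (α β A B t r : ℝ) (p : ℝ[X]) :
    functional α β A B t (Polynomial.C r * p) = r * functional α β A B t p := by
  unfold functional
  rw [← intervalIntegral.integral_const_mul]
  congr 1
  ext x
  rw [Polynomial.eval_mul, Polynomial.eval_C]
  ring

lemma functional_sum {α β : ℝ} (hα : 0 < α) (hβ : 0 < β) (A B t : ℝ) {ι : Type*}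
    (s : Finset ι) (f : ι → ℝ[X]) :
    functional α β A B t (∑ i ∈ s, f i) = ∑ i ∈ s, functional α β A B t (f i) := by
  unfold functional
  rw [← intervalIntegral.integral_finsetSum
    (fun i _ => integrable_mul_weight hα hβ A B t (f i))]
  congr 1
  ext x
  rw [Polynomial.eval_finsetSum, Finset.sum_mul]

lemma functional_sq_pos {α β A B t : ℝ} (hα : 0 < α) (hβ : 0 < β) (hA : 0 ≤ A)
    (hAB : 0 ≤ A + B) (ht0 : 0 ≤ t) (ht1 : t < 1) (hne : (0 < A ∧ 0 < t) ∨ 0 < A + B)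
    {p : ℝ[X]} (hp : p ≠ 0) : 0 < functional α β A B t (p ^ 2) := by
  have hj : ∀ x, 0 ≤ A + B * heaviside (x - t) := by
    intro x
    unfold heaviside
    split_ifs <;> simp [hA, hAB]
  have key : ∃ a b : ℝ, 0 ≤ a ∧ a < b ∧ b ≤ 1 ∧
      ∀ x ∈ Ioo a b, 0 < A + B * heaviside (x - t) := by
    rcases hne with ⟨h1, h2⟩ | h
    · refine ⟨0, t, le_rfl, h2, ht1.le, fun x hx => ?_⟩
      have : ¬ (0 ≤ x - t) := by linarith [hx.2]
      simp [heaviside, this, h1]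
    · refine ⟨t, 1, ht0, ht1, le_rfl, fun x hx => ?_⟩
      have : 0 ≤ x - t := by linarith [hx.1]
      simp only [heaviside, this, if_true]
      linarith
  obtain ⟨a, b, ha, hab, hb, hpos⟩ := key
  unfold functional
  rw [intervalIntegral.integral_pos_iff_support_of_nonneg_ae']
  · refine ⟨zero_lt_one, ?_⟩
    have hsub : Ioo a b \ (p.roots.toFinset : Set ℝ) ⊆
        Function.support (fun x => (p ^ 2).eval x * weight α β A B t x) ∩ Ioc 0 1 := by
      rintro x ⟨hx, hr⟩
      have hx0 : 0 < x := lt_of_le_of_lt ha hx.1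
      have hx1 : x < 1 := lt_of_lt_of_le hx.2 hb
      refine ⟨?_, hx0, hx1.le⟩
      rw [Function.mem_support, Polynomial.eval_pow]
      have hpx : p.eval x ≠ 0 := by
        intro h0
        apply hr
        simp [hp, h0]
      refine mul_ne_zero (pow_ne_zero 2 hpx) ?_
      unfold weight
      exact (mul_pos (mul_pos (Real.rpow_pos_of_pos hx0 _)
        (Real.rpow_pos_of_pos (by linarith) _)) (hpos x hx)).ne'
    refine lt_of_lt_of_le ?_ (MeasureTheory.measure_mono hsub)
    rw [MeasureTheory.measure_sdiff_null (Finset.measure_zero _ _), Real.volume_Ioo]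
    simpa using hab
  · rw [uIoc_of_le zero_le_one]
    refine (MeasureTheory.ae_restrict_iff' measurableSet_Ioc).2
      (Filter.Eventually.of_forall fun x hx => ?_)
    simp only [Pi.zero_apply, Polynomial.eval_pow]
    unfold weight
    exact mul_nonneg (sq_nonneg _) (mul_nonneg (mul_nonneg (Real.rpow_nonneg hx.1.le _)
      (Real.rpow_nonneg (by linarith [hx.2]) _)) (hj x))
  · exact integrable_mul_weight hα hβ A B t _

/-- `h_n(t) > 0`. -/
lemma functional_orthoPoly_sq_pos {α β A B t : ℝ} (hα : 0 < α) (hβ : 0 < β) (hA : 0 ≤ A)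
    (hAB : 0 ≤ A + B) (ht0 : 0 ≤ t) (ht1 : t < 1) (hne : (0 < A ∧ 0 < t) ∨ 0 < A + B) (n : ℕ) :
    0 < functional α β A B t (orthoPoly α β A B t n ^ 2) :=
  functional_sq_pos hα hβ hA hAB ht0 ht1 hne (orthoPoly_monic_natDegree α β A B t n).1.ne_zero

/-- `P_m` and `P_n` are orthogonal for `m < n`. -/
lemma functional_orthoPoly_mul {α β A B t : ℝ} (hα : 0 < α) (hβ : 0 < β) (hA : 0 ≤ A)
    (hAB : 0 ≤ A + B) (ht0 : 0 ≤ t) (ht1 : t < 1) (hne : (0 < A ∧ 0 < t) ∨ 0 < A + B)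
    (n m : ℕ) (hmn : m < n) :
    functional α β A B t (orthoPoly α β A B t n * orthoPoly α β A B t m) = 0 := by
  induction n using Nat.strong_induction_on generalizing m with
  | _ n ih =>
    rw [orthoPoly_eq α β A B t n, sub_mul, functional_sub hα hβ, Finset.sum_mul,
      functional_sum hα hβ, Finset.sum_eq_single (⟨m, hmn⟩ : Fin n)]
    · rw [mul_assoc, functional_C_mul, ← sq, div_mul_cancel₀ _
        (functional_orthoPoly_sq_pos hα hβ hA hAB ht0 ht1 hne m).ne', sub_self]
    · intro k _ hk
      have hkm : k.1 ≠ m := fun h => hk (Fin.ext h)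
      rw [mul_assoc, functional_C_mul]
      rcases lt_or_gt_of_ne hkm with h | h
      · rw [mul_comm (orthoPoly α β A B t k.1), ih m hmn k.1 h, mul_zero]
      · rw [ih k.1 k.2 m h, mul_zero]
    · intro h
      exact absurd (Finset.mem_univ _) h

end PerturbedJacobi

end

/-!
The sixth Painlevé equation for the Jacobi weight with a jump at `t`, by way of the ladder system
for the pair `(P_n, P_{n+1})`, that is the linear system in `x` with simple poles at `0`, `1` and
`t` that expresses `P_n'` and `P_{n+1}'` through `P_n` and `P_{n+1}`, and its deformation in `t`.
Only the residues of that system and its regular part at `t` enter. Pairing `P_n` with `P_{n+1}`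
rather than with `P_{n-1}` makes `n = 0` an ordinary case.

Write `ω = B t^α (1-t)^β` for the height of the jump and `h = h_n`. Three linear forms on
polynomials, the integrals of `p`, `p/x` and `p/(1-x)` against the weight, are tied by integration
by parts (`functional_derivative`). Applied to `P_n²`, `x P_n²`, `P_n P_{n+1}`, `x P_n P_{n+1}`
and `P_{n+1}²`, this gives linear relations between the integrals `a₀, b₀, e₀` of `α P_n²/x`, `α
P_n P_{n+1}/x`, `α P_{n+1}²/x` (divided by `h`), their analogues `a₁, -b₁, e₁` at `1`, and the
residue `R = ω P_n(t)²/h` at `t`. In particular `x_n = a₁ = c + t R` and `a₀ = c - (1-t) R` with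
`c = 2n+1+α+β`. The Christoffel–Darboux formula at `0` and at `1` shows that the residues of the
ladder system have rank one there: `a₀ e₀ = b₀ (b₀ - α)` and `a₁ e₁ = b₁ (b₁ - β)`
(`IsPearson.det_zero`, `IsPearson.det_one`).

Differentiating the orthogonality relations in `t` expresses the time derivative of `P_n` by the
Christoffel–Darboux kernel (`eval_timeDeriv`). In `d/dt P_n(t;t)`, the sum of the derivatives in
time and in space, the value of the kernel on the diagonal cancels, and a linear system for
`P_n(t;t)` and `P_{n+1}(t;t)` without singular terms remains (`exists_ladder`). Where `R ≠ 0` it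
becomes a closed first-order system for `R` and `y = b₀ - α - a₀ P_{n+1}(t;t)/P_n(t;t)`
(`hasDerivAt_system`); here the rank-one relations are what eliminates the remaining coefficients
(`momentum_identity`). Since `W = t a₀/c` and `1 - W = (1-t) a₁/c`, positivity of `a₀` and `a₁`
keeps `W` away from `0` and `1`, and eliminating `y` yields the Painlevé equation
(`painleveVIAt_of_system`). Finally `W = t - t (1-t) R/c`, so that the smoothness of the moments
in `t` gives that of `W`, and the continuity of `R` at `0`, where it vanishes, gives the
derivative of `W` there.
-/

namespace PerturbedJacobi

/-! ### The weight and integration by parts -/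

section

open MeasureTheory intervalIntegral

/-- The unperturbed Jacobi weight `x^α (1-x)^β`. -/
noncomputable def jacobiWeight (α β x : ℝ) : ℝ := x ^ α * (1 - x) ^ β

lemma weight_eq (α β A B t x : ℝ) :
    weight α β A B t x = jacobiWeight α β x * (A + B * heaviside (x - t)) := rfl

lemma continuous_jacobiWeight {α β : ℝ} (hα : 0 < α) (hβ : 0 < β) :
    Continuous (jacobiWeight α β) :=
  (Real.continuous_rpow_const hα.le).mul
    ((Real.continuous_rpow_const hβ.le).comp (continuous_const.sub continuous_id))

lemma jacobiWeight_zero {α β : ℝ} (hα : 0 < α) : jacobiWeight α β 0 = 0 := by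
  simp [jacobiWeight, hα.ne']

lemma jacobiWeight_one {α β : ℝ} (hβ : 0 < β) : jacobiWeight α β 1 = 0 := by
  simp [jacobiWeight, hβ.ne']

lemma jacobiWeight_pos {α β x : ℝ} (hx : x ∈ Ioo (0 : ℝ) 1) : 0 < jacobiWeight α β x :=
  mul_pos (Real.rpow_pos_of_pos hx.1 _) (Real.rpow_pos_of_pos (by linarith [hx.2]) _)

lemma hasDerivAt_jacobiWeight (α β : ℝ) {x : ℝ} (hx : x ∈ Ioo (0 : ℝ) 1) :
    HasDerivAt (jacobiWeight α β) ((α / x - β / (1 - x)) * jacobiWeight α β x) x := by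
  have h0 : x ≠ 0 := hx.1.ne'
  have h1 : 1 - x ≠ 0 := by linarith [hx.2]
  have d0 := Real.hasDerivAt_rpow_const (x := x) (p := α) (Or.inl h0)
  have d1 := ((hasDerivAt_id x).const_sub 1).rpow_const (p := β) (Or.inl h1)
  refine (d0.mul d1).congr_deriv ?_
  simp only [id, jacobiWeight, Real.rpow_sub_one h0, Real.rpow_sub_one h1]
  field_simp
  ring

lemma contDiffOn_jacobiWeight (α β : ℝ) (k : WithTop ℕ∞) :
    ContDiffOn ℝ k (jacobiWeight α β) (Ioo 0 1) := by
  intro x hx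
  have h0 : x ≠ 0 := hx.1.ne'
  have h1 : 1 - x ≠ 0 := by linarith [hx.2]
  exact ((Real.contDiffAt_rpow_const_of_ne h0).mul
    ((contDiffAt_const.sub contDiffAt_id).rpow_const_of_ne h1)).contDiffWithinAt

lemma mul_step_eq (f : ℝ → ℝ) (A B t : ℝ) :
    (fun x => f x * (A + B * heaviside (x - t))) =
      fun x => A * f x + B * (Ici t).indicator f x := by
  ext x
  by_cases h : t ≤ x <;> simp [heaviside, h, indicator] <;> ring

lemma intervalIntegrable_mul_step {f : ℝ → ℝ} (hf : IntervalIntegrable f volume 0 1)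
    (A B t : ℝ) :
    IntervalIntegrable (fun x => f x * (A + B * heaviside (x - t))) volume 0 1 := by
  rw [mul_step_eq]
  refine (hf.const_mul A).add (IntervalIntegrable.const_mul ?_ B)
  exact ⟨hf.1.indicator measurableSet_Ici, hf.2.indicator measurableSet_Ici⟩

/-- The jump of the step function splits an integral into an integral over `[0,1]` and one
over `[t,1]`. -/
lemma integral_mul_step {f : ℝ → ℝ} (hf : IntervalIntegrable f volume 0 1)
    (A B : ℝ) {t : ℝ} (ht : t ∈ Icc (0 : ℝ) 1) :
    ∫ x in (0 : ℝ)..1, f x * (A + B * heaviside (x - t)) =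
      A * (∫ x in (0 : ℝ)..1, f x) + B * ∫ x in t..1, f x := by
  have hi : IntervalIntegrable ((Ici t).indicator f) volume 0 1 :=
    ⟨hf.1.indicator measurableSet_Ici, hf.2.indicator measurableSet_Ici⟩
  rw [mul_step_eq, intervalIntegral.integral_add (hf.const_mul A) (hi.const_mul B),
    intervalIntegral.integral_const_mul, intervalIntegral.integral_const_mul]
  congr 2
  have h0 : ∫ x in (0 : ℝ)..t, (Ici t).indicator f x = 0 := by
    rw [intervalIntegral.integral_of_le ht.1, integral_Ioc_eq_integral_Ioo]
    refine setIntegral_eq_zero_of_forall_eq_zero fun x hx => ?_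
    simp [indicator, hx.2]
  have h1 : ∫ x in t..1, (Ici t).indicator f x = ∫ x in t..1, f x := by
    refine intervalIntegral.integral_congr fun x hx => ?_
    rw [uIcc_of_le ht.2] at hx
    simp [indicator, hx.1]
  have hs0 : uIcc 0 t ⊆ uIcc (0 : ℝ) 1 := by
    rw [uIcc_of_le ht.1, uIcc_of_le zero_le_one]; exact Icc_subset_Icc le_rfl ht.2
  have hs1 : uIcc t 1 ⊆ uIcc (0 : ℝ) 1 := by
    rw [uIcc_of_le ht.2, uIcc_of_le zero_le_one]; exact Icc_subset_Icc ht.1 le_rfl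
  rw [← intervalIntegral.integral_add_adjacent_intervals (hi.mono_set hs0) (hi.mono_set hs1),
    h0, h1, zero_add]

lemma intervalIntegrable_div_self_mul_jacobiWeight {α β : ℝ} (hα : 0 < α) (hβ : 0 < β)
    (p : ℝ[X]) :
    IntervalIntegrable (fun x => p.eval x / x * jacobiWeight α β x) volume 0 1 := by
  have h1 : IntervalIntegrable (fun x : ℝ => x ^ (α - 1)) volume 0 1 :=
    intervalIntegral.intervalIntegrable_rpow' (by linarith)
  have hc : Continuous (fun x : ℝ => p.eval x * (1 - x) ^ β) :=
    p.continuous.mul ((Real.continuous_rpow_const hβ.le).comp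
      (continuous_const.sub continuous_id))
  refine (h1.continuousOn_mul hc.continuousOn).congr fun x hx => ?_
  rw [uIoc_of_le zero_le_one] at hx
  simp only [jacobiWeight, Real.rpow_sub_one hx.1.ne']
  field_simp

lemma intervalIntegrable_div_one_sub_mul_jacobiWeight {α β : ℝ} (hα : 0 < α) (hβ : 0 < β)
    (p : ℝ[X]) :
    IntervalIntegrable (fun x => p.eval x / (1 - x) * jacobiWeight α β x) volume 0 1 := by
  have h := (intervalIntegrable_div_self_mul_jacobiWeight hβ hα
    (p.comp (1 - Polynomial.X))).comp_sub_left 1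
  rw [sub_zero, sub_self] at h
  refine h.symm.congr fun x _ => ?_
  simp [jacobiWeight, mul_comm]

/-- Integration of `p(x)/x` against the weight. -/
noncomputable def functionalZero (α β A B t : ℝ) (p : ℝ[X]) : ℝ :=
  ∫ x in (0 : ℝ)..1, p.eval x / x * weight α β A B t x

/-- Integration of `p(x)/(1-x)` against the weight. -/
noncomputable def functionalOne (α β A B t : ℝ) (p : ℝ[X]) : ℝ :=
  ∫ x in (0 : ℝ)..1, p.eval x / (1 - x) * weight α β A B t x

lemma integrable_functionalZero {α β : ℝ} (hα : 0 < α) (hβ : 0 < β) (A B t : ℝ) (p : ℝ[X]) :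
    IntervalIntegrable (fun x => p.eval x / x * weight α β A B t x) volume 0 1 := by
  refine (intervalIntegrable_mul_step
    (intervalIntegrable_div_self_mul_jacobiWeight hα hβ p) A B t).congr fun x _ => ?_
  simp only [weight_eq]; ring

lemma integrable_functionalOne {α β : ℝ} (hα : 0 < α) (hβ : 0 < β) (A B t : ℝ) (p : ℝ[X]) :
    IntervalIntegrable (fun x => p.eval x / (1 - x) * weight α β A B t x) volume 0 1 := by
  refine (intervalIntegrable_mul_step
    (intervalIntegrable_div_one_sub_mul_jacobiWeight hα hβ p) A B t).congr fun x _ => ?_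
  simp only [weight_eq]; ring

/-- `functional` as a linear form. -/
noncomputable def functionalHom {α β : ℝ} (hα : 0 < α) (hβ : 0 < β) (A B t : ℝ) :
    ℝ[X] →ₗ[ℝ] ℝ where
  toFun := functional α β A B t
  map_add' p q := by
    have := functional_sub hα hβ A B t (p + q) q
    rw [add_sub_cancel_right] at this
    linarith
  map_smul' r p := by
    rw [Polynomial.smul_eq_C_mul, functional_C_mul]; rfl

/-- `functionalZero` as a linear form. -/
noncomputable def functionalZeroHom {α β : ℝ} (hα : 0 < α) (hβ : 0 < β) (A B t : ℝ) :
    ℝ[X] →ₗ[ℝ] ℝ where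
  toFun := functionalZero α β A B t
  map_add' p q := by
    unfold functionalZero
    rw [← intervalIntegral.integral_add (integrable_functionalZero hα hβ A B t p)
      (integrable_functionalZero hα hβ A B t q)]
    congr 1; ext x; rw [Polynomial.eval_add]; ring
  map_smul' r p := by
    unfold functionalZero
    rw [RingHom.id_apply, smul_eq_mul, ← intervalIntegral.integral_const_mul]
    congr 1; ext x; rw [Polynomial.eval_smul, smul_eq_mul]; ring

/-- `functionalOne` as a linear form. -/
noncomputable def functionalOneHom {α β : ℝ} (hα : 0 < α) (hβ : 0 < β) (A B t : ℝ) :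
    ℝ[X] →ₗ[ℝ] ℝ where
  toFun := functionalOne α β A B t
  map_add' p q := by
    unfold functionalOne
    rw [← intervalIntegral.integral_add (integrable_functionalOne hα hβ A B t p)
      (integrable_functionalOne hα hβ A B t q)]
    congr 1; ext x; rw [Polynomial.eval_add]; ring
  map_smul' r p := by
    unfold functionalOne
    rw [RingHom.id_apply, smul_eq_mul, ← intervalIntegral.integral_const_mul]
    congr 1; ext x; rw [Polynomial.eval_smul, smul_eq_mul]; ring

lemma functionalZero_X_mul {α β : ℝ} (hα : 0 < α) (A B t : ℝ) (p : ℝ[X]) :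
    functionalZero α β A B t (Polynomial.X * p) = functional α β A B t p := by
  unfold functionalZero functional
  refine intervalIntegral.integral_congr fun x _ => ?_
  rcases eq_or_ne x 0 with rfl | h
  · simp [weight_eq, jacobiWeight_zero hα]
  · simp [h]

lemma functionalOne_one_sub_X_mul {α β : ℝ} (hβ : 0 < β) (A B t : ℝ) (p : ℝ[X]) :
    functionalOne α β A B t ((1 - Polynomial.X) * p) = functional α β A B t p := by
  unfold functionalOne functional
  refine intervalIntegral.integral_congr fun x _ => ?_
  rcases eq_or_ne x 1 with rfl | h
  · simp [weight_eq, jacobiWeight_one hβ]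
  · have : 1 - x ≠ 0 := sub_ne_zero.2 h.symm
    simp [this]

lemma weight_nonneg {α β A B t x : ℝ} (hA : 0 ≤ A) (hAB : 0 ≤ A + B)
    (hx : x ∈ Icc (0 : ℝ) 1) : 0 ≤ weight α β A B t x := by
  refine mul_nonneg (mul_nonneg (Real.rpow_nonneg hx.1 _)
    (Real.rpow_nonneg (by linarith [hx.2]) _)) ?_
  unfold heaviside
  split_ifs <;> simp [hA, hAB]

lemma functional_sq_le_functionalZero {α β A B t : ℝ} (hα : 0 < α) (hβ : 0 < β) (hA : 0 ≤ A)
    (hAB : 0 ≤ A + B) (p : ℝ[X]) :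
    functional α β A B t (p ^ 2) ≤ functionalZero α β A B t (p ^ 2) := by
  refine intervalIntegral.integral_mono_on_of_le_Ioo zero_le_one
    (integrable_mul_weight hα hβ A B t _) (integrable_functionalZero hα hβ A B t _)
    fun x hx => mul_le_mul_of_nonneg_right ?_ (weight_nonneg hA hAB ⟨hx.1.le, hx.2.le⟩)
  rw [Polynomial.eval_pow]
  exact le_div_self (sq_nonneg _) hx.1 hx.2.le

lemma functional_sq_le_functionalOne {α β A B t : ℝ} (hα : 0 < α) (hβ : 0 < β) (hA : 0 ≤ A)
    (hAB : 0 ≤ A + B) (p : ℝ[X]) :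
    functional α β A B t (p ^ 2) ≤ functionalOne α β A B t (p ^ 2) := by
  refine intervalIntegral.integral_mono_on_of_le_Ioo zero_le_one
    (integrable_mul_weight hα hβ A B t _) (integrable_functionalOne hα hβ A B t _)
    fun x hx => mul_le_mul_of_nonneg_right ?_ (weight_nonneg hA hAB ⟨hx.1.le, hx.2.le⟩)
  rw [Polynomial.eval_pow]
  exact le_div_self (sq_nonneg _) (by linarith [hx.2]) (by linarith [hx.1])

/-- Integration by parts against the weight; the jump at `t` contributes the last term. -/
lemma functional_derivative {α β : ℝ} (hα : 0 < α) (hβ : 0 < β) (A B : ℝ) {t : ℝ}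
    (ht : t ∈ Icc (0 : ℝ) 1) (p : ℝ[X]) :
    functional α β A B t (Polynomial.derivative p) + α * functionalZero α β A B t p
      - β * functionalOne α β A B t p + B * jacobiWeight α β t * p.eval t = 0 := by
  set F : ℝ → ℝ := fun x => p.eval x * jacobiWeight α β x with hF
  set g : ℝ → ℝ := fun x => (Polynomial.derivative p).eval x * jacobiWeight α β x
    + α * (p.eval x / x * jacobiWeight α β x) - β * (p.eval x / (1 - x) * jacobiWeight α β x)
    with hg
  have hFc : Continuous F := p.continuous.mul (continuous_jacobiWeight hα hβ)
  have hd : ∀ x ∈ Ioo (0 : ℝ) 1, HasDerivAt F (g x) x := fun x hx =>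
    ((p.hasDerivAt x).mul (hasDerivAt_jacobiWeight α β hx)).congr_deriv (by simp only [hg]; ring)
  have hi : IntervalIntegrable g volume 0 1 :=
    ((((Polynomial.derivative p).continuous.mul
      (continuous_jacobiWeight hα hβ)).intervalIntegrable _ _).add
      ((intervalIntegrable_div_self_mul_jacobiWeight hα hβ p).const_mul α)).sub
      ((intervalIntegrable_div_one_sub_mul_jacobiWeight hα hβ p).const_mul β)
  have hs : uIcc t 1 ⊆ uIcc (0 : ℝ) 1 := by
    rw [uIcc_of_le ht.2, uIcc_of_le zero_le_one]; exact Icc_subset_Icc ht.1 le_rfl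
  have e0 : ∫ x in (0 : ℝ)..1, g x = F 1 - F 0 :=
    intervalIntegral.integral_eq_sub_of_hasDerivAt_of_le zero_le_one hFc.continuousOn hd hi
  have e1 : ∫ x in t..1, g x = F 1 - F t :=
    intervalIntegral.integral_eq_sub_of_hasDerivAt_of_le ht.2 hFc.continuousOn
      (fun x hx => hd x ⟨ht.1.trans_lt hx.1, hx.2⟩) (hi.mono_set hs)
  have e2 := integral_mul_step hi A B ht
  rw [e0, e1] at e2
  have e3 : ∫ x in (0 : ℝ)..1, g x * (A + B * heaviside (x - t)) =
      functional α β A B t (Polynomial.derivative p) + α * functionalZero α β A B t p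
      - β * functionalOne α β A B t p := by
    unfold functional functionalZero functionalOne
    rw [← intervalIntegral.integral_const_mul, ← intervalIntegral.integral_const_mul,
      ← intervalIntegral.integral_add (integrable_mul_weight hα hβ A B t _)
        ((integrable_functionalZero hα hβ A B t p).const_mul α),
      ← intervalIntegral.integral_sub ((integrable_mul_weight hα hβ A B t _).add
        ((integrable_functionalZero hα hβ A B t p).const_mul α))
        ((integrable_functionalOne hα hβ A B t p).const_mul β)]
    congr 1; ext x
    simp only [hg, weight_eq]; ring
  rw [← e3, e2]
  simp only [hF, jacobiWeight_zero hα, jacobiWeight_one hβ]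
  ring

end

/-! ### Monic orthogonal polynomials of a linear form -/

section

open Polynomial

/-- `P` is the sequence of monic orthogonal polynomials of the linear form `L`. -/
structure IsMonicOrtho (L : ℝ[X] →ₗ[ℝ] ℝ) (P : ℕ → ℝ[X]) : Prop where
  monic : ∀ n, (P n).Monic
  natDegree : ∀ n, (P n).natDegree = n
  ortho : ∀ n m, m < n → L (P n * P m) = 0
  sq_ne_zero : ∀ n, L (P n ^ 2) ≠ 0

/-- The Christoffel–Darboux kernel `y ↦ ∑_{k ≤ n} P_k(x) P_k(y) / h_k`, as a polynomial
in `y`. -/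
noncomputable def cdKernel (L : ℝ[X] →ₗ[ℝ] ℝ) (P : ℕ → ℝ[X]) (n : ℕ) (x : ℝ) : ℝ[X] :=
  ∑ k ∈ Finset.range (n + 1), C ((P k).eval x / L (P k ^ 2)) * P k

lemma map_C_mul (L : ℝ[X] →ₗ[ℝ] ℝ) (r : ℝ) (p : ℝ[X]) : L (C r * p) = r * L p := by
  rw [← smul_eq_C_mul, map_smul, smul_eq_mul]

/-- A linear form vanishing on monic polynomials of each degree below `n` vanishes on all
polynomials of degree below `n`. -/
lemma map_eq_zero_of_degree_lt {P : ℕ → ℝ[X]} (hm : ∀ n, (P n).Monic)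
    (hd : ∀ n, (P n).natDegree = n) (φ : ℝ[X] →ₗ[ℝ] ℝ) (n : ℕ)
    (h : ∀ k < n, φ (P k) = 0) (s : ℝ[X]) (hs : s.degree < n) : φ s = 0 := by
  induction n generalizing s with
  | zero =>
    have : s = 0 := by simpa using hs
    simp [this]
  | succ n ih =>
    have hlow : (s - C (s.coeff n) * P n).degree < n := by
      rw [degree_lt_iff_coeff_zero]
      intro m hmn
      rw [coeff_sub, coeff_C_mul]
      rcases hmn.eq_or_lt with rfl | hlt
      · have : (P n).coeff n = 1 := by
          have := (hm n).coeff_natDegree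
          rwa [hd n] at this
        rw [this]; ring
      · rw [(degree_lt_iff_coeff_zero _ _).1 hs m hlt,
          coeff_eq_zero_of_natDegree_lt (p := P n) (by rw [hd n]; exact hlt)]
        ring
    have h1 := ih (fun k hk => h k (by omega)) _ hlow
    rw [map_sub, map_C_mul, h n (by omega)] at h1
    linarith

namespace IsMonicOrtho

variable {L : ℝ[X] →ₗ[ℝ] ℝ} {P : ℕ → ℝ[X]}

lemma coeff_self (H : IsMonicOrtho L P) (n : ℕ) : (P n).coeff n = 1 := by
  have := (H.monic n).coeff_natDegree
  rwa [H.natDegree n] at this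

lemma coeff_eq_zero (H : IsMonicOrtho L P) {n m : ℕ} (h : n < m) : (P n).coeff m = 0 :=
  coeff_eq_zero_of_natDegree_lt (by rw [H.natDegree n]; exact h)

lemma degree_lt_succ (H : IsMonicOrtho L P) (n : ℕ) : (P n).degree < (n + 1 : ℕ) := by
  rw [degree_lt_iff_coeff_zero]
  exact fun m hm => H.coeff_eq_zero (by omega)

lemma map_mul_eq_zero (H : IsMonicOrtho L P)
    {n : ℕ} {s : ℝ[X]} (hs : s.degree < n) : L (P n * s) = 0 :=
  map_eq_zero_of_degree_lt H.monic H.natDegree (L ∘ₗ LinearMap.mulLeft ℝ (P n)) n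
    (fun k hk => H.ortho n k hk) s hs

lemma map_mul_eq_coeff_mul (H : IsMonicOrtho L P) {n : ℕ} {s : ℝ[X]} (hs : s.degree < (n + 1 : ℕ)) :
    L (P n * s) = s.coeff n * L (P n ^ 2) := by
  have h := H.map_mul_eq_zero (n := n) (s := s - C (s.coeff n) * P n) (by
    rw [degree_lt_iff_coeff_zero]
    intro m hmn
    rw [coeff_sub, coeff_C_mul]
    rcases hmn.eq_or_lt with rfl | hlt
    · rw [H.coeff_self]; ring
    · rw [(degree_lt_iff_coeff_zero _ _).1 hs m hlt, H.coeff_eq_zero hlt]; ring)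
  rw [show P n * (s - C (s.coeff n) * P n) = P n * s - C (s.coeff n) * P n ^ 2 by ring,
    map_sub, map_C_mul] at h
  linarith

lemma degree_cdKernel_lt (H : IsMonicOrtho L P)
    (n : ℕ) (x : ℝ) : (cdKernel L P n x).degree < (n + 1 : ℕ) := by
  rw [degree_lt_iff_coeff_zero]
  intro m hm
  rw [cdKernel, finsetSum_coeff]
  refine Finset.sum_eq_zero fun k hk => ?_
  rw [coeff_C_mul, H.coeff_eq_zero (by have := Finset.mem_range.1 hk; omega), mul_zero]

lemma coeff_cdKernel (H : IsMonicOrtho L P) (n : ℕ) (x : ℝ) :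
    (cdKernel L P n x).coeff n = (P n).eval x / L (P n ^ 2) := by
  rw [cdKernel, finsetSum_coeff, Finset.sum_range_succ, Finset.sum_eq_zero, coeff_C_mul,
    H.coeff_self]
  · ring
  · intro k hk
    rw [coeff_C_mul, H.coeff_eq_zero (Finset.mem_range.1 hk), mul_zero]

/-- The kernel reproduces polynomials of degree at most `n`. -/
lemma map_mul_cdKernel (H : IsMonicOrtho L P)
    {n : ℕ} (x : ℝ) {s : ℝ[X]} (hs : s.degree < (n + 1 : ℕ)) :
    L (s * cdKernel L P n x) = s.eval x := by
  have h := map_eq_zero_of_degree_lt H.monic H.natDegree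
    (L ∘ₗ LinearMap.mulLeft ℝ (cdKernel L P n x) - leval x) (n + 1) ?_ s hs
  · simp only [LinearMap.sub_apply, LinearMap.comp_apply, LinearMap.mulLeft_apply,
      leval_apply] at h
    rw [mul_comm]; linarith
  · intro k hk
    simp only [LinearMap.sub_apply, LinearMap.comp_apply, LinearMap.mulLeft_apply, leval_apply]
    rw [cdKernel, Finset.sum_mul, map_sum,
      Finset.sum_eq_single_of_mem k (Finset.mem_range.2 hk), mul_assoc, map_C_mul, ← sq,
      div_mul_cancel₀ _ (H.sq_ne_zero k), sub_self]
    intro j _ hj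
    rw [mul_assoc, map_C_mul]
    rcases lt_or_gt_of_ne hj with h | h
    · rw [mul_comm (P j), H.ortho k j h, mul_zero]
    · rw [H.ortho j k h, mul_zero]

/-- The Christoffel–Darboux formula. -/
lemma X_sub_C_mul_cdKernel (H : IsMonicOrtho L P) (n : ℕ) (x : ℝ) :
    (X - C x) * cdKernel L P n x =
      C ((P n).eval x / L (P n ^ 2)) * P (n + 1)
        - C ((P (n + 1)).eval x / L (P n ^ 2)) * P n := by
  have hh := H.sq_ne_zero n
  set K := cdKernel L P n x with hK
  set D : ℝ[X] := (X - C x) * K - (C ((P n).eval x / L (P n ^ 2)) * P (n + 1)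
        - C ((P (n + 1)).eval x / L (P n ^ 2)) * P n) with hD
  have hKd := (degree_lt_iff_coeff_zero _ _).1 (H.degree_cdKernel_lt n x)
  -- The leading coefficients cancel, so that `D` has degree at most `n`.
  have hDdeg : D.degree < (n + 1 : ℕ) := by
    rw [degree_lt_iff_coeff_zero]
    intro m hm
    obtain ⟨m, rfl⟩ : ∃ k, m = k + 1 := ⟨m - 1, by omega⟩
    have hm' : n ≤ m := by omega
    simp only [hD, sub_mul, coeff_sub, coeff_C_mul, coeff_X_mul]
    rw [← hK] at hKd
    rw [hKd (m + 1) (by omega), H.coeff_eq_zero (show n < m + 1 by omega)]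
    rcases hm'.eq_or_lt with rfl | hlt
    · rw [hK, H.coeff_cdKernel, H.coeff_self]; ring
    · rw [hKd m (by omega), H.coeff_eq_zero (show n + 1 < m + 1 by omega)]; ring
  have horth : ∀ k ≤ n, L (D * P k) = 0 := by
    intro k hk
    have e : D * P k = (X * P k - C x * P k) * K
        - (C ((P n).eval x / L (P n ^ 2)) * (P (n + 1) * P k)
        - C ((P (n + 1)).eval x / L (P n ^ 2)) * (P n * P k)) := by
      rw [hD]; ring
    rw [e, map_sub, map_sub, map_C_mul, map_C_mul, H.ortho (n + 1) k (by omega)]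
    rcases hk.eq_or_lt with rfl | hlt
    · have e2 : (X * P k - C x * P k) * K
          = (X * P k - P (k + 1)) * K + P (k + 1) * K - C x * (P k * K) := by ring
      rw [e2, map_sub, map_add, map_C_mul, hK, H.map_mul_eq_zero (H.degree_cdKernel_lt k x),
        H.map_mul_cdKernel x, H.map_mul_cdKernel x, ← sq]
      · simp only [eval_sub, eval_mul, eval_X]
        field_simp
        ring
      · rw [degree_lt_iff_coeff_zero]
        intro m hm; exact H.coeff_eq_zero (by omega)
      · rw [degree_lt_iff_coeff_zero]
        intro m hm
        obtain ⟨m, rfl⟩ : ∃ j, m = j + 1 := ⟨m - 1, by omega⟩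
        rw [coeff_sub, coeff_X_mul]
        rcases (show k ≤ m by omega).eq_or_lt with rfl | h2
        · rw [H.coeff_self, H.coeff_self, sub_self]
        · rw [H.coeff_eq_zero h2, H.coeff_eq_zero (by omega), sub_self]
    · rw [H.map_mul_cdKernel x, H.ortho n k hlt]
      · simp
      · rw [degree_lt_iff_coeff_zero]
        intro m hm
        obtain ⟨m, rfl⟩ : ∃ j, m = j + 1 := ⟨m - 1, by omega⟩
        rw [coeff_sub, coeff_X_mul, coeff_C_mul, H.coeff_eq_zero (show k < m by omega),
          H.coeff_eq_zero (show k < m + 1 by omega)]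
        ring
  -- A polynomial of degree at most `n` orthogonal to all such polynomials is zero.
  have hDzero : D = 0 := by
    refine Polynomial.funext fun y => ?_
    rw [← H.map_mul_cdKernel y hDdeg, eval_zero]
    exact map_eq_zero_of_degree_lt H.monic H.natDegree (L ∘ₗ LinearMap.mulLeft ℝ D) (n + 1)
      (fun k hk => horth k (by omega)) _ (H.degree_cdKernel_lt n y)
  exact sub_eq_zero.1 hDzero

/-- Consecutive orthogonal polynomials have no common zero. -/
lemma eval_ne_zero_or (H : IsMonicOrtho L P)
    (n : ℕ) (x : ℝ) : (P n).eval x ≠ 0 ∨ (P (n + 1)).eval x ≠ 0 := by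
  by_contra! hcon
  have h := H.X_sub_C_mul_cdKernel n x
  rw [hcon.1, hcon.2] at h
  simp only [zero_div, map_zero, zero_mul, sub_zero] at h
  have hK : cdKernel L P n x = 0 := (mul_eq_zero.1 h).resolve_left (X_sub_C_ne_zero x)
  have h1 := H.map_mul_cdKernel (n := n) x (s := 1) (by
    rw [degree_one]; exact_mod_cast Nat.succ_pos n)
  rw [hK, mul_zero, map_zero, eval_one] at h1
  exact zero_ne_one h1

end IsMonicOrtho

end

/-! ### Algebraic relations at a fixed time -/

section

open Polynomial

/-- The algebraic properties of the three linear forms given by integration of `p(x)`,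
`p(x)/x` and `p(x)/(1-x)` against the weight; `ω` stands for the height of the jump
at `t`. -/
structure IsPearson (α β ω t : ℝ) (L Z O : ℝ[X] →ₗ[ℝ] ℝ) : Prop where
  zero_X_mul : ∀ p, Z (X * p) = L p
  one_one_sub_X_mul : ∀ p, O ((1 - X) * p) = L p
  parts : ∀ p, L (derivative p) + α * Z p - β * O p + ω * p.eval t = 0

lemma eq_zero_of_mul_eq_mul {x y a b c d : ℝ} (h : x ≠ 0 ∨ y ≠ 0) (h1 : x * a = y * b)
    (h2 : x * c = y * d) : a * d = b * c := by
  rcases h with h | h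
  · apply mul_left_cancel₀ h; linear_combination d * h1 - b * h2
  · apply mul_left_cancel₀ h; linear_combination c * h1 - a * h2

namespace IsPearson

variable {α β ω t : ℝ} {L Z O : ℝ[X] →ₗ[ℝ] ℝ} {P : ℕ → ℝ[X]}

lemma one_X_mul (J : IsPearson α β ω t L Z O) (p : ℝ[X]) : O (X * p) = O p - L p := by
  rw [← J.one_one_sub_X_mul p, ← map_sub]
  congr 1; ring

lemma degree_derivative_lt (H : IsMonicOrtho L P) (n : ℕ) :
    (derivative (P n)).degree < n := by
  rw [degree_lt_iff_coeff_zero]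
  intro m hm
  rw [coeff_derivative, H.coeff_eq_zero (by omega), zero_mul]

lemma map_mul_derivative (H : IsMonicOrtho L P) (n : ℕ) :
    L (P n * derivative (P n)) = 0 :=
  H.map_mul_eq_zero (degree_derivative_lt H n)

lemma map_mul_derivative_succ (H : IsMonicOrtho L P) (n : ℕ) :
    L (P n * derivative (P (n + 1))) = (n + 1) * L (P n ^ 2) := by
  rw [H.map_mul_eq_coeff_mul (degree_derivative_lt H (n + 1)), coeff_derivative, H.coeff_self]
  ring

lemma map_succ_mul_derivative (H : IsMonicOrtho L P) (n : ℕ) :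
    L (P (n + 1) * derivative (P n)) = 0 :=
  H.map_mul_eq_zero ((degree_derivative_lt H n).trans (by exact_mod_cast n.lt_succ_self))

lemma map_mul_X_mul_derivative (H : IsMonicOrtho L P) (n : ℕ) :
    L (P n * (X * derivative (P n))) = n * L (P n ^ 2) := by
  have hc : ∀ m, (X * derivative (P n)).coeff m = m * (P n).coeff m := by
    rintro (_ | m)
    · simp
    · rw [coeff_X_mul, coeff_derivative]; push_cast; ring
  rw [H.map_mul_eq_coeff_mul, hc, H.coeff_self, mul_one]
  rw [degree_lt_iff_coeff_zero]
  intro m hm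
  rw [hc, H.coeff_eq_zero (by omega), mul_zero]

lemma parts_sq (J : IsPearson α β ω t L Z O) (H : IsMonicOrtho L P) (n : ℕ) :
    α * Z (P n ^ 2) - β * O (P n ^ 2) + ω * (P n).eval t ^ 2 = 0 := by
  have h := J.parts (P n ^ 2)
  rw [show derivative (P n ^ 2) = C 2 * (P n * derivative (P n)) by
    rw [derivative_sq]; ring, map_C_mul, map_mul_derivative H, eval_pow] at h
  linarith

lemma parts_X_mul_sq (J : IsPearson α β ω t L Z O) (H : IsMonicOrtho L P) (n : ℕ) :
    (2 * n + 1 + α + β) * L (P n ^ 2) - β * O (P n ^ 2) + t * (ω * (P n).eval t ^ 2) = 0 := by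
  have h := J.parts (X * P n ^ 2)
  rw [show derivative (X * P n ^ 2) = P n ^ 2 + C 2 * (P n * (X * derivative (P n))) by
    rw [derivative_mul, derivative_sq, derivative_X]; ring, map_add, map_C_mul,
    map_mul_X_mul_derivative H, J.zero_X_mul, J.one_X_mul, eval_mul, eval_X, eval_pow] at h
  linarith

lemma parts_mul (J : IsPearson α β ω t L Z O) (H : IsMonicOrtho L P) (n : ℕ) :
    (n + 1) * L (P n ^ 2) + α * Z (P n * P (n + 1)) - β * O (P n * P (n + 1))
      + ω * ((P n).eval t * (P (n + 1)).eval t) = 0 := by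
  have h := J.parts (P n * P (n + 1))
  rw [derivative_mul, map_add, mul_comm (derivative _), map_succ_mul_derivative H,
    map_mul_derivative_succ H, eval_mul] at h
  linarith

lemma parts_X_mul_mul (J : IsPearson α β ω t L Z O) (H : IsMonicOrtho L P) (n : ℕ) :
    (P (n + 1)).coeff n * L (P n ^ 2) =
      -(β * O (P n * P (n + 1))) + t * (ω * ((P n).eval t * (P (n + 1)).eval t)) := by
  have h := J.parts (X * (P n * P (n + 1)))
  have h0 : L (P n * P (n + 1)) = 0 := by rw [mul_comm]; exact H.ortho _ _ n.lt_succ_self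
  have h1 : L (P (n + 1) * (X * derivative (P n))) = 0 := by
    refine H.map_mul_eq_zero ?_
    rw [degree_lt_iff_coeff_zero]
    intro m hm
    obtain ⟨m, rfl⟩ : ∃ k, m = k + 1 := ⟨m - 1, by omega⟩
    rw [coeff_X_mul, coeff_derivative, H.coeff_eq_zero (by omega), zero_mul]
  -- `X P_{n+1}' - (n+1) P_{n+1}` has degree `n`.
  have h2 : L (P n * (X * derivative (P (n + 1)) - C ((n : ℝ) + 1) * P (n + 1)))
      = -((P (n + 1)).coeff n * L (P n ^ 2)) := by
    have hc : ∀ m : ℕ, (X * derivative (P (n + 1)) - C ((n : ℝ) + 1) * P (n + 1)).coeff m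
        = ((m : ℝ) - (n + 1)) * (P (n + 1)).coeff m := by
      rintro (_ | m)
      · simp; ring
      · rw [coeff_sub, coeff_C_mul, coeff_X_mul, coeff_derivative]; push_cast; ring
    rw [H.map_mul_eq_coeff_mul, hc]
    · ring
    · rw [degree_lt_iff_coeff_zero]
      intro m hm
      rw [hc]
      rcases hm.eq_or_lt with rfl | hlt
      · push_cast; ring
      · rw [H.coeff_eq_zero hlt, mul_zero]
  rw [show derivative (X * (P n * P (n + 1))) = P n * P (n + 1)
      + P (n + 1) * (X * derivative (P n))
      + (P n * (X * derivative (P (n + 1)) - C ((n : ℝ) + 1) * P (n + 1))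
        + C ((n : ℝ) + 1) * (P n * P (n + 1))) by
    rw [derivative_mul, derivative_mul, derivative_X]; ring, map_add, map_add, map_add,
    map_C_mul, h0, h1, h2, J.zero_X_mul, J.one_X_mul, h0, eval_mul, eval_mul, eval_X] at h
  linarith

/-- The residue at `0` of the ladder system has rank one. -/
lemma det_zero (J : IsPearson α β ω t L Z O) (H : IsMonicOrtho L P) (n : ℕ) :
    (α * Z (P n ^ 2)) * (α * Z (P (n + 1) ^ 2)) =
      (α * Z (P n * P (n + 1))) * (α * Z (P n * P (n + 1)) - α * L (P n ^ 2)) := by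
  have hh := H.sq_ne_zero n
  have key : ∀ f, L (f * cdKernel L P n 0) * L (P n ^ 2) =
      (P n).eval 0 * Z (f * P (n + 1)) - (P (n + 1)).eval 0 * Z (f * P n) := by
    intro f
    have h := congrArg (fun s => Z (f * s)) (H.X_sub_C_mul_cdKernel n 0)
    simp only [mul_sub, mul_left_comm f (C _), map_sub, map_C_mul] at h
    rw [map_zero, sub_zero, mul_left_comm, J.zero_X_mul] at h
    rw [h]; field_simp
  have k1 := key (P n)
  have k2 := key (P (n + 1))
  rw [H.map_mul_cdKernel 0 (H.degree_lt_succ n), ← sq] at k1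
  rw [H.map_mul_eq_zero (H.degree_cdKernel_lt n 0), ← sq, mul_comm (P (n + 1)) (P n)] at k2
  have := eq_zero_of_mul_eq_mul (H.eval_ne_zero_or n 0)
    (a := α * Z (P n * P (n + 1)) - α * L (P n ^ 2)) (b := α * Z (P n ^ 2))
    (c := α * Z (P (n + 1) ^ 2)) (d := α * Z (P n * P (n + 1)))
    (by linear_combination -α * k1) (by linear_combination -α * k2)
  linarith

/-- The residue at `1` of the ladder system has rank one. -/
lemma det_one (J : IsPearson α β ω t L Z O) (H : IsMonicOrtho L P) (n : ℕ) :
    (β * O (P n ^ 2)) * (β * O (P (n + 1) ^ 2)) =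
      (β * O (P n * P (n + 1))) * (β * O (P n * P (n + 1)) + β * L (P n ^ 2)) := by
  have hh := H.sq_ne_zero n
  have key : ∀ f, -(L (f * cdKernel L P n 1) * L (P n ^ 2)) =
      (P n).eval 1 * O (f * P (n + 1)) - (P (n + 1)).eval 1 * O (f * P n) := by
    intro f
    have h := congrArg (fun s => O (f * s)) (H.X_sub_C_mul_cdKernel n 1)
    simp only [mul_sub, mul_left_comm f (C _), map_sub, map_C_mul] at h
    rw [map_one, mul_left_comm, show (X - 1) * (f * cdKernel L P n 1)
      = -((1 - X) * (f * cdKernel L P n 1)) by ring, map_neg, J.one_one_sub_X_mul] at h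
    rw [← neg_mul, h]; field_simp
  have k1 := key (P n)
  have k2 := key (P (n + 1))
  rw [H.map_mul_cdKernel 1 (H.degree_lt_succ n), ← sq] at k1
  rw [H.map_mul_eq_zero (H.degree_cdKernel_lt n 1), ← sq, mul_comm (P (n + 1)) (P n)] at k2
  have := eq_zero_of_mul_eq_mul (H.eval_ne_zero_or n 1)
    (a := β * O (P n * P (n + 1)) + β * L (P n ^ 2)) (b := β * O (P n ^ 2))
    (c := β * O (P (n + 1) ^ 2)) (d := β * O (P n * P (n + 1)))
    (by linear_combination -β * k1) (by linear_combination -β * k2)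
  linarith

/-- Integration by parts against the Christoffel–Darboux kernel. -/
lemma eval_derivative_add (J : IsPearson α β ω t L Z O) (H : IsMonicOrtho L P) (n : ℕ)
    {x : ℝ} (h0 : x ≠ 0) (h1 : 1 - x ≠ 0) {f : ℝ[X]}
    (hf : (derivative f).degree < (n + 1 : ℕ))
    (hK : L (f * derivative (cdKernel L P n x)) = 0) :
    (derivative f).eval x + ω * f.eval t * (cdKernel L P n x).eval t =
      -α / x * (L (f * cdKernel L P n x) - ((P n).eval x * Z (f * P (n + 1))
          - (P (n + 1)).eval x * Z (f * P n)) / L (P n ^ 2))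
      + β / (1 - x) * (L (f * cdKernel L P n x) + ((P n).eval x * O (f * P (n + 1))
          - (P (n + 1)).eval x * O (f * P n)) / L (P n ^ 2)) := by
  have hh := H.sq_ne_zero n
  have cd := H.X_sub_C_mul_cdKernel n x
  set K := cdKernel L P n x with hKdef
  have hp := J.parts (f * K)
  rw [derivative_mul, map_add, hK, hKdef, H.map_mul_cdKernel x hf, ← hKdef, eval_mul] at hp
  have hZ : x * Z (f * K) = L (f * K) - ((P n).eval x * Z (f * P (n + 1))
          - (P (n + 1)).eval x * Z (f * P n)) / L (P n ^ 2) := by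
    have h := congrArg (fun s => Z (f * s)) cd
    simp only [mul_sub, mul_left_comm f (C _), map_sub, map_C_mul] at h
    rw [show f * ((X - C x) * K) = X * (f * K) - C x * (f * K) by ring, map_sub, map_C_mul,
      J.zero_X_mul] at h
    linear_combination -h
  have hO : (1 - x) * O (f * K) = L (f * K) + ((P n).eval x * O (f * P (n + 1))
          - (P (n + 1)).eval x * O (f * P n)) / L (P n ^ 2) := by
    have h := congrArg (fun s => O (f * s)) cd
    simp only [mul_sub, mul_left_comm f (C _), map_sub, map_C_mul] at h
    rw [show f * ((X - C x) * K) = X * (f * K) - C x * (f * K) by ring, map_sub, map_C_mul,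
      J.one_X_mul] at h
    linear_combination h
  rw [← hZ, ← hO]
  field_simp
  linear_combination hp

lemma degree_derivative_cdKernel_lt (H : IsMonicOrtho L P) (n : ℕ) (x : ℝ) :
    (derivative (cdKernel L P n x)).degree < n := by
  have hKd := (degree_lt_iff_coeff_zero _ _).1 (H.degree_cdKernel_lt n x)
  rw [degree_lt_iff_coeff_zero]
  intro m hm
  rw [coeff_derivative, hKd _ (by omega), zero_mul]

lemma eval_derivative_add_self (J : IsPearson α β ω t L Z O) (H : IsMonicOrtho L P) (n : ℕ)
    {x : ℝ} (h0 : x ≠ 0) (h1 : 1 - x ≠ 0) :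
    (derivative (P n)).eval x + ω * (P n).eval t * (cdKernel L P n x).eval t =
      -α / x * ((P n).eval x - ((P n).eval x * Z (P n * P (n + 1))
          - (P (n + 1)).eval x * Z (P n ^ 2)) / L (P n ^ 2))
      + β / (1 - x) * ((P n).eval x + ((P n).eval x * O (P n * P (n + 1))
          - (P (n + 1)).eval x * O (P n ^ 2)) / L (P n ^ 2)) := by
  rw [J.eval_derivative_add H n h0 h1
    ((degree_derivative_lt H n).trans (by exact_mod_cast n.lt_succ_self))
    (H.map_mul_eq_zero (degree_derivative_cdKernel_lt H n x)),
    H.map_mul_cdKernel x (H.degree_lt_succ n), ← sq]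

lemma eval_derivative_add_succ (J : IsPearson α β ω t L Z O) (H : IsMonicOrtho L P) (n : ℕ)
    {x : ℝ} (h0 : x ≠ 0) (h1 : 1 - x ≠ 0) :
    (derivative (P (n + 1))).eval x
        + ω * (P (n + 1)).eval t * (cdKernel L P n x).eval t =
      α / x * (((P n).eval x * Z (P (n + 1) ^ 2)
          - (P (n + 1)).eval x * Z (P n * P (n + 1))) / L (P n ^ 2))
      + β / (1 - x) * (((P n).eval x * O (P (n + 1) ^ 2)
          - (P (n + 1)).eval x * O (P n * P (n + 1))) / L (P n ^ 2)) := by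
  rw [J.eval_derivative_add H n h0 h1 (degree_derivative_lt H (n + 1))
    (H.map_mul_eq_zero ((degree_derivative_cdKernel_lt H n x).trans
      (by exact_mod_cast n.lt_succ_self))),
    H.map_mul_eq_zero (H.degree_cdKernel_lt n x), ← sq, mul_comm (P (n + 1)) (P n)]
  ring

end IsPearson

end

/-! ### Families of polynomials depending on time -/

section

open Polynomial intervalIntegral MeasureTheory

/-- A family of polynomials of bounded degree whose coefficients are `C^k` on `S`. -/
structure IsContDiffFamily (k : WithTop ℕ∞) (S : Set ℝ) (Q : ℝ → ℝ[X]) : Prop where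
  coeff : ∀ i, ContDiffOn ℝ k (fun s => (Q s).coeff i) S
  bounded : ∃ N, ∀ s, (Q s).natDegree < N

/-- A family of polynomials of bounded degree, differentiable at `t` coefficient by
coefficient, with derivative the polynomial `Q'`. -/
structure HasPolyDerivAt (Q : ℝ → ℝ[X]) (Q' : ℝ[X]) (t : ℝ) : Prop where
  coeff : ∀ i, HasDerivAt (fun s => (Q s).coeff i) (Q'.coeff i) t
  bounded : ∃ N, ∀ s, (Q s).natDegree < N

lemma bounded_mul {Q R : ℝ → ℝ[X]} (hQ : ∃ N, ∀ s, (Q s).natDegree < N)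
    (hR : ∃ N, ∀ s, (R s).natDegree < N) : ∃ N, ∀ s, (Q s * R s).natDegree < N := by
  obtain ⟨N, hN⟩ := hQ
  obtain ⟨M, hM⟩ := hR
  exact ⟨N + M, fun s => natDegree_mul_le.trans_lt (add_lt_add (hN s) (hM s))⟩

lemma functional_eq_sum {α β : ℝ} (hα : 0 < α) (hβ : 0 < β) (A B t : ℝ) {p : ℝ[X]} {N : ℕ}
    (hp : p.natDegree < N) :
    functional α β A B t p =
      ∑ i ∈ Finset.range N, p.coeff i * functional α β A B t (X ^ i) := by
  conv_lhs => rw [p.as_sum_range_C_mul_X_pow' hp]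
  rw [functional_sum hα hβ]
  simp only [functional_C_mul]

namespace IsContDiffFamily

variable {k : WithTop ℕ∞} {S : Set ℝ} {Q R : ℝ → ℝ[X]}

lemma const (p : ℝ[X]) : IsContDiffFamily k S (fun _ => p) :=
  ⟨fun _ => contDiffOn_const, ⟨p.natDegree + 1, fun _ => Nat.lt_succ_self _⟩⟩

lemma mul (hQ : IsContDiffFamily k S Q) (hR : IsContDiffFamily k S R) :
    IsContDiffFamily k S (fun s => Q s * R s) := by
  refine ⟨fun i => ?_, bounded_mul hQ.bounded hR.bounded⟩
  simp only [coeff_mul]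
  exact ContDiffOn.sum fun x _ => (hQ.coeff x.1).mul (hR.coeff x.2)

lemma eval_self (hQ : IsContDiffFamily k S Q) :
    ContDiffOn ℝ k (fun s => (Q s).eval s) S := by
  obtain ⟨N, hN⟩ := hQ.bounded
  simp only [fun s => eval_eq_sum_range' (hN s) s]
  exact ContDiffOn.sum fun i _ => (hQ.coeff i).mul (contDiffOn_id.pow i)

lemma functional {α β : ℝ} (hα : 0 < α) (hβ : 0 < β) {A B : ℝ}
    (hm : ∀ j : ℕ, ContDiffOn ℝ k (fun s => functional α β A B s (X ^ j)) S)
    (hQ : IsContDiffFamily k S Q) :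
    ContDiffOn ℝ k (fun s => functional α β A B s (Q s)) S := by
  obtain ⟨N, hN⟩ := hQ.bounded
  simp only [fun s => functional_eq_sum hα hβ A B s (hN s)]
  exact ContDiffOn.sum fun i _ => (hQ.coeff i).mul (hm i)

/-- The orthogonal polynomials depend on time as smoothly as the moments of the weight. -/
lemma orthoPoly {α β : ℝ} (hα : 0 < α) (hβ : 0 < β) {A B : ℝ}
    (hm : ∀ j : ℕ, ContDiffOn ℝ k (fun s => PerturbedJacobi.functional α β A B s (X ^ j)) S)
    (hne : ∀ n, ∀ s ∈ S, PerturbedJacobi.functional α β A B s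
      (PerturbedJacobi.orthoPoly α β A B s n ^ 2) ≠ 0) (n : ℕ) :
    IsContDiffFamily k S (fun s => PerturbedJacobi.orthoPoly α β A B s n) := by
  induction n using Nat.strong_induction_on with
  | _ n ih =>
    refine ⟨fun i => ?_, n + 1, fun s => by
      rw [(orthoPoly_monic_natDegree α β A B s n).2]; exact n.lt_succ_self⟩
    simp only [fun s => orthoPoly_eq α β A B s n, coeff_sub, finsetSum_coeff, coeff_C_mul]
    refine contDiffOn_const.sub (ContDiffOn.sum fun j _ => ContDiffOn.mul (ContDiffOn.div
      (IsContDiffFamily.functional hα hβ hm ((const (X ^ n)).mul (ih j.1 j.2)))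
      (IsContDiffFamily.functional hα hβ hm ?_) (hne j.1)) ((ih j.1 j.2).coeff i))
    simpa only [sq] using (ih j.1 j.2).mul (ih j.1 j.2)

/-- The coefficientwise derivative of a differentiable family. -/
lemma exists_hasPolyDerivAt (hQ : IsContDiffFamily k S Q) (hk : k ≠ 0) {t : ℝ}
    (hS : S ∈ nhds t) : ∃ Q', HasPolyDerivAt Q Q' t := by
  obtain ⟨N, hN⟩ := hQ.bounded
  refine ⟨∑ i ∈ Finset.range N, C (deriv (fun s => (Q s).coeff i) t) * X ^ i,
    fun i => ?_, N, hN⟩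
  have hd : HasDerivAt (fun s => (Q s).coeff i) (deriv (fun s => (Q s).coeff i) t) t :=
    (((hQ.coeff i).contDiffAt hS).differentiableAt hk).hasDerivAt
  refine hd.congr_deriv ?_
  simp only [finsetSum_coeff, coeff_C_mul, coeff_X_pow, mul_ite, mul_one, mul_zero,
    Finset.sum_ite_eq, Finset.mem_range]
  split_ifs with h
  · rfl
  · have : (fun s => (Q s).coeff i) = fun _ => 0 :=
      funext fun s => coeff_eq_zero_of_natDegree_lt (by have := hN s; omega)
    rw [this, deriv_const]

end IsContDiffFamily

/-- A moment as the sum of an unperturbed moment and an integral over `[t,1]`. -/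
lemma functional_eq_integral {α β : ℝ} (hα : 0 < α) (hβ : 0 < β) (A B : ℝ) {t : ℝ}
    (ht : t ∈ Icc (0 : ℝ) 1) (p : ℝ[X]) :
    functional α β A B t p = A * (∫ x in (0 : ℝ)..1, p.eval x * jacobiWeight α β x)
      + B * ∫ x in t..1, p.eval x * jacobiWeight α β x := by
  have hc : Continuous fun x => p.eval x * jacobiWeight α β x :=
    p.continuous.mul (continuous_jacobiWeight hα hβ)
  rw [← integral_mul_step (hc.intervalIntegrable _ _) A B ht]
  unfold functional
  congr 1; ext x; rw [weight_eq]; ring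

lemma hasDerivAt_functional_const {α β : ℝ} (hα : 0 < α) (hβ : 0 < β) (A B : ℝ) {t : ℝ}
    (ht : t ∈ Ioo (0 : ℝ) 1) (p : ℝ[X]) :
    HasDerivAt (fun s => functional α β A B s p)
      (-(B * jacobiWeight α β t * p.eval t)) t := by
  have hc : Continuous fun x => p.eval x * jacobiWeight α β x :=
    p.continuous.mul (continuous_jacobiWeight hα hβ)
  have hd := ((intervalIntegral.integral_hasDerivAt_left (hc.intervalIntegrable t 1)
    hc.stronglyMeasurable.stronglyMeasurableAtFilter hc.continuousAt).const_mul B).const_add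
    (A * ∫ x in (0 : ℝ)..1, p.eval x * jacobiWeight α β x)
  refine (hd.congr_of_eventuallyEq ?_).congr_deriv (by ring)
  filter_upwards [Icc_mem_nhds ht.1 ht.2] with s hs
  exact functional_eq_integral hα hβ A B hs p

lemma continuousOn_functional_const {α β : ℝ} (hα : 0 < α) (hβ : 0 < β) (A B : ℝ) (p : ℝ[X]) :
    ContinuousOn (fun s => functional α β A B s p) (Icc 0 1) := by
  have hc : Continuous fun x => p.eval x * jacobiWeight α β x :=
    p.continuous.mul (continuous_jacobiWeight hα hβ)
  have h : Continuous fun s => A * (∫ x in (0 : ℝ)..1, p.eval x * jacobiWeight α β x)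
      + B * ∫ x in s..1, p.eval x * jacobiWeight α β x := by
    refine continuous_const.add (continuous_const.mul ?_)
    simp only [fun s => intervalIntegral.integral_symm (f := fun x =>
      p.eval x * jacobiWeight α β x) (μ := volume) 1 s]
    exact (intervalIntegral.continuous_primitive (fun a b => hc.intervalIntegrable a b) 1).neg
  exact h.continuousOn.congr fun s hs => functional_eq_integral hα hβ A B hs p

lemma contDiffOn_functional_const {α β : ℝ} (hα : 0 < α) (hβ : 0 < β) (A B : ℝ) (p : ℝ[X]) :
    ContDiffOn ℝ 2 (fun s => functional α β A B s p) (Ioo 0 1) := by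
  rw [show (2 : WithTop ℕ∞) = 1 + 1 by norm_num, contDiffOn_succ_iff_deriv_of_isOpen isOpen_Ioo]
  refine ⟨fun t ht => (hasDerivAt_functional_const hα hβ A B
    ht p).differentiableAt.differentiableWithinAt, by simp, ?_⟩
  refine ContDiffOn.congr (f := fun t => -(B * jacobiWeight α β t * p.eval t)) ?_
    fun t ht => (hasDerivAt_functional_const hα hβ A B ht p).deriv
  exact ((contDiffOn_const.mul (contDiffOn_jacobiWeight α β 1)).mul
    (IsContDiffFamily.const p).eval_self).neg

namespace HasPolyDerivAt

variable {Q R : ℝ → ℝ[X]} {Q' R' : ℝ[X]} {t : ℝ}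

lemma const (p : ℝ[X]) (t : ℝ) : HasPolyDerivAt (fun _ => p) 0 t :=
  ⟨fun i => by simpa using hasDerivAt_const t (p.coeff i),
    ⟨p.natDegree + 1, fun _ => Nat.lt_succ_self _⟩⟩

lemma mul (hQ : HasPolyDerivAt Q Q' t) (hR : HasPolyDerivAt R R' t) :
    HasPolyDerivAt (fun s => Q s * R s) (Q' * R t + Q t * R') t := by
  refine ⟨fun i => ?_, bounded_mul hQ.bounded hR.bounded⟩
  simp only [coeff_mul, coeff_add, ← Finset.sum_add_distrib]
  exact HasDerivAt.fun_sum fun x _ => (hQ.coeff x.1).mul (hR.coeff x.2)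

lemma natDegree_lt (hQ : HasPolyDerivAt Q Q' t) :
    ∃ N, (∀ s, (Q s).natDegree < N) ∧ Q'.natDegree < N := by
  obtain ⟨N, hN⟩ := hQ.bounded
  have hpos : 0 < N := (Nat.zero_le _).trans_lt (hN t)
  refine ⟨N, hN, ?_⟩
  rw [← Nat.le_sub_one_iff_lt hpos, natDegree_le_iff_coeff_eq_zero]
  intro i hi
  have h0 : (fun s => (Q s).coeff i) = fun _ => 0 :=
    funext fun s => coeff_eq_zero_of_natDegree_lt (by have := hN s; omega)
  have := hQ.coeff i
  rw [h0] at this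
  exact this.unique (hasDerivAt_const t 0)

lemma eval_self (hQ : HasPolyDerivAt Q Q' t) :
    HasDerivAt (fun s => (Q s).eval s) (Q'.eval t + (derivative (Q t)).eval t) t := by
  obtain ⟨N, hN, hN'⟩ := hQ.natDegree_lt
  have h1 := HasDerivAt.fun_sum (u := Finset.range N) fun i _ =>
    (hQ.coeff i).mul (hasDerivAt_pow i t)
  have e1 : (fun s => (Q s).eval s) = fun s => ∑ i ∈ Finset.range N, (Q s).coeff i * s ^ i :=
    funext fun s => eval_eq_sum_range' (hN s) s
  rw [e1]
  refine h1.congr_deriv ?_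
  rw [Finset.sum_add_distrib, ← eval_eq_sum_range' hN']
  congr 1
  conv_rhs => rw [(Q t).as_sum_range_C_mul_X_pow' (hN t)]
  simp [eval_finsetSum, derivative_X_pow]

lemma functional {α β : ℝ} (hα : 0 < α) (hβ : 0 < β) (A B : ℝ) (ht : t ∈ Ioo (0 : ℝ) 1)
    (hQ : HasPolyDerivAt Q Q' t) :
    HasDerivAt (fun s => functional α β A B s (Q s))
      (functional α β A B t Q' - B * jacobiWeight α β t * (Q t).eval t) t := by
  obtain ⟨N, hN, hN'⟩ := hQ.natDegree_lt
  have h1 := HasDerivAt.fun_sum (u := Finset.range N) fun i _ =>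
    (hQ.coeff i).mul (hasDerivAt_functional_const hα hβ A B ht (X ^ i))
  have e1 : (fun s => PerturbedJacobi.functional α β A B s (Q s)) = fun s =>
      ∑ i ∈ Finset.range N, (Q s).coeff i * PerturbedJacobi.functional α β A B s (X ^ i) :=
    funext fun s => functional_eq_sum hα hβ A B s (hN s)
  rw [e1]
  refine h1.congr_deriv ?_
  rw [Finset.sum_add_distrib, ← functional_eq_sum hα hβ A B t hN', sub_eq_add_neg,
    eval_eq_sum_range' (hN t) t, Finset.mul_sum, ← Finset.sum_neg_distrib]
  congr 1
  refine Finset.sum_congr rfl fun i _ => ?_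
  rw [eval_pow, eval_X]; ring

end HasPolyDerivAt

end

/-! ### Time evolution of the orthogonal polynomials -/

section Evolution

open Polynomial

variable {α β A B : ℝ}

/-- The condition under which the weight with step at `t ∈ [0,1)` is non-negative and does
not vanish identically. -/
structure IsAdmissible (α β A B t : ℝ) : Prop where
  pos_left : 0 < α
  pos_right : 0 < β
  nonneg : 0 ≤ A
  nonneg_add : 0 ≤ A + B
  mem : t ∈ Ico (0 : ℝ) 1
  nontrivial : (0 < A ∧ 0 < t) ∨ 0 < A + B

lemma IsAdmissible.normSq_pos {t : ℝ} (h : IsAdmissible α β A B t) (n : ℕ) :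
    0 < normSq α β A B n t :=
  functional_orthoPoly_sq_pos h.pos_left h.pos_right h.nonneg h.nonneg_add h.mem.1 h.mem.2
    h.nontrivial n

lemma IsAdmissible.isMonicOrtho {t : ℝ} (h : IsAdmissible α β A B t) :
    IsMonicOrtho (functionalHom h.pos_left h.pos_right A B t) (orthoPoly α β A B t) where
  monic n := (orthoPoly_monic_natDegree α β A B t n).1
  natDegree n := (orthoPoly_monic_natDegree α β A B t n).2
  ortho n m hmn := functional_orthoPoly_mul h.pos_left h.pos_right h.nonneg h.nonneg_add
    h.mem.1 h.mem.2 h.nontrivial n m hmn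
  sq_ne_zero n := (h.normSq_pos n).ne'

lemma IsAdmissible.isPearson {t : ℝ} (h : IsAdmissible α β A B t) :
    IsPearson α β (B * jacobiWeight α β t) t (functionalHom h.pos_left h.pos_right A B t)
      (functionalZeroHom h.pos_left h.pos_right A B t)
      (functionalOneHom h.pos_left h.pos_right A B t) where
  zero_X_mul := functionalZero_X_mul h.pos_left A B t
  one_one_sub_X_mul := functionalOne_one_sub_X_mul h.pos_right A B t
  parts := functional_derivative h.pos_left h.pos_right A B ⟨h.mem.1, h.mem.2.le⟩

/-- `P_n` being monic, its time derivative has degree below `n`. -/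
lemma degree_timeDeriv_lt {n : ℕ} {t : ℝ} {Q' : ℝ[X]}
    (hQ : HasPolyDerivAt (fun s => orthoPoly α β A B s n) Q' t) : Q'.degree < n := by
  rw [degree_lt_iff_coeff_zero]
  intro m hm
  have hc : (fun s => (orthoPoly α β A B s n).coeff m) = fun _ => if m = n then 1 else 0 := by
    funext s
    have h := orthoPoly_monic_natDegree α β A B s n
    split_ifs with hmn
    · have := h.1.coeff_natDegree
      subst hmn; rwa [h.2] at this
    · exact coeff_eq_zero_of_natDegree_lt (by rw [h.2]; omega)
  have := hQ.coeff m
  rw [hc] at this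
  exact this.unique (hasDerivAt_const t _)

/-- The time derivative `Q'` of `P_n` satisfies `∫ Q' s w = ω P_n(t) s(t)` for all `s` of degree
below `n`, where `ω` is the height of the jump of the weight: differentiate `∫ P_n s w = 0`. -/
lemma functional_timeDeriv_mul {n : ℕ} {t : ℝ} {Q' : ℝ[X]} (ht : t ∈ Ioo (0 : ℝ) 1)
    (h : ∀ s ∈ Ioo (0 : ℝ) 1, IsAdmissible α β A B s)
    (hQ : HasPolyDerivAt (fun s => orthoPoly α β A B s n) Q' t) {s : ℝ[X]}
    (hs : s.degree < n) :
    functional α β A B t (Q' * s) =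
      B * jacobiWeight α β t * (orthoPoly α β A B t n).eval t * s.eval t := by
  have hα := (h t ht).pos_left
  have hβ := (h t ht).pos_right
  have h1 := (hQ.mul (HasPolyDerivAt.const s t)).functional hα hβ A B ht
  have h2 : (fun r => functional α β A B r (orthoPoly α β A B r n * s)) =ᶠ[nhds t]
      fun _ => 0 := by
    filter_upwards [Ioo_mem_nhds ht.1 ht.2] with r hr
    exact (h r hr).isMonicOrtho.map_mul_eq_zero hs
  have h3 := h1.unique ((hasDerivAt_const t (0 : ℝ)).congr_of_eventuallyEq h2)
  rw [mul_zero, add_zero, eval_mul] at h3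
  linarith

lemma hasDerivAt_normSq {n : ℕ} {t : ℝ} {Q' : ℝ[X]} (ht : t ∈ Ioo (0 : ℝ) 1)
    (h : ∀ s ∈ Ioo (0 : ℝ) 1, IsAdmissible α β A B s)
    (hQ : HasPolyDerivAt (fun s => orthoPoly α β A B s n) Q' t) :
    HasDerivAt (normSq α β A B n)
      (-(B * jacobiWeight α β t * (orthoPoly α β A B t n).eval t ^ 2)) t := by
  have h1 := (hQ.mul hQ).functional (h t ht).pos_left (h t ht).pos_right A B ht
  have h0 : functional α β A B t (orthoPoly α β A B t n * Q') = 0 :=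
    (h t ht).isMonicOrtho.map_mul_eq_zero (degree_timeDeriv_lt hQ)
  have h2 : functional α β A B t (Q' * orthoPoly α β A B t n
      + orthoPoly α β A B t n * Q') = 0 := by
    rw [mul_comm Q', ← two_mul, ← map_ofNat C 2, functional_C_mul, h0, mul_zero]
  rw [h2, eval_mul] at h1
  have e : normSq α β A B n = fun s => functional α β A B s
      (orthoPoly α β A B s n * orthoPoly α β A B s n) := by
    funext s; rw [normSq, sq]
  rw [e]
  exact h1.congr_deriv (by ring)

lemma eval_timeDeriv_succ {n : ℕ} {t : ℝ} {Q' : ℝ[X]} (ht : t ∈ Ioo (0 : ℝ) 1)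
    (h : ∀ s ∈ Ioo (0 : ℝ) 1, IsAdmissible α β A B s)
    (hQ : HasPolyDerivAt (fun s => orthoPoly α β A B s (n + 1)) Q' t) (x : ℝ) :
    Q'.eval x = B * jacobiWeight α β t * (orthoPoly α β A B t (n + 1)).eval t *
      (cdKernel (functionalHom (h t ht).pos_left (h t ht).pos_right A B t)
        (orthoPoly α β A B t) n x).eval t := by
  have H := (h t ht).isMonicOrtho
  rw [← functional_timeDeriv_mul ht h hQ (H.degree_cdKernel_lt n x)]
  exact (H.map_mul_cdKernel x (degree_timeDeriv_lt hQ)).symm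

lemma eval_timeDeriv {n : ℕ} {t : ℝ} {Q' : ℝ[X]} (ht : t ∈ Ioo (0 : ℝ) 1)
    (h : ∀ s ∈ Ioo (0 : ℝ) 1, IsAdmissible α β A B s)
    (hQ : HasPolyDerivAt (fun s => orthoPoly α β A B s n) Q' t) (x : ℝ) :
    Q'.eval x = B * jacobiWeight α β t * (orthoPoly α β A B t n).eval t *
      ((cdKernel (functionalHom (h t ht).pos_left (h t ht).pos_right A B t)
        (orthoPoly α β A B t) n x).eval t
        - (orthoPoly α β A B t n).eval x * (orthoPoly α β A B t n).eval t
          / normSq α β A B n t) := by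
  have H := (h t ht).isMonicOrtho
  set K := cdKernel (functionalHom (h t ht).pos_left (h t ht).pos_right A B t)
    (orthoPoly α β A B t) n x with hK
  have hd := degree_timeDeriv_lt hQ
  -- Removing the last term of the kernel leaves a polynomial of degree below `n`.
  have hlow : (K - C ((orthoPoly α β A B t n).eval x / normSq α β A B n t) *
      orthoPoly α β A B t n).degree < n := by
    have hKd := (degree_lt_iff_coeff_zero _ _).1 (H.degree_cdKernel_lt n x)
    rw [degree_lt_iff_coeff_zero]
    intro m hm
    rw [coeff_sub, coeff_C_mul]
    rcases hm.eq_or_lt with rfl | hlt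
    · rw [H.coeff_self, hK, H.coeff_cdKernel]
      exact sub_eq_zero.2 (mul_one _).symm
    · rw [H.coeff_eq_zero hlt, hK, hKd m (by omega)]; ring
  have h1 := functional_timeDeriv_mul ht h hQ hlow
  have h2 : functional α β A B t (Q' * K) = Q'.eval x :=
    H.map_mul_cdKernel x (hd.trans (by exact_mod_cast n.lt_succ_self))
  have h3 : functional α β A B t (orthoPoly α β A B t n * Q') = 0 := H.map_mul_eq_zero hd
  rw [mul_sub, functional_sub (h t ht).pos_left (h t ht).pos_right, h2, mul_left_comm,
    functional_C_mul, mul_comm Q', h3, mul_zero, sub_zero, eval_sub, eval_mul, eval_C] at h1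
  rw [h1]; ring

lemma coeff_timeDeriv_succ {n : ℕ} {t : ℝ} {Q' : ℝ[X]} (ht : t ∈ Ioo (0 : ℝ) 1)
    (h : ∀ s ∈ Ioo (0 : ℝ) 1, IsAdmissible α β A B s)
    (hQ : HasPolyDerivAt (fun s => orthoPoly α β A B s (n + 1)) Q' t) :
    Q'.coeff n = B * jacobiWeight α β t * (orthoPoly α β A B t (n + 1)).eval t *
      (orthoPoly α β A B t n).eval t / normSq α β A B n t := by
  have H := (h t ht).isMonicOrtho
  have h1 := functional_timeDeriv_mul ht h hQ (H.degree_lt_succ n)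
  have h2 : functional α β A B t (orthoPoly α β A B t n * Q') =
      Q'.coeff n * normSq α β A B n t := H.map_mul_eq_coeff_mul (degree_timeDeriv_lt hQ)
  rw [mul_comm, h2] at h1
  rw [← h1, mul_div_cancel_right₀ _ ((h t ht).normSq_pos n).ne']

end Evolution

/-! ### Elimination of the momentum -/

/-- The algebra behind the equation for the momentum `y = -(n+1+α) - σ - c κ`, where `κ = v/u` and
`σ' = R κ`. The left side is `y'`, with `κ' = v'/u - κ u'/u` computed from the linear system of
`exists_ladder`; the rank-one relations and `e₀ - e₁ + R κ² = 0` eliminate `κ`. -/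
lemma momentum_identity {t α β N c R κ y a₀ a₁ b₀ b₁ e₀ e₁ : ℝ} (ht0 : t ≠ 0) (ht1 : 1 - t ≠ 0)
    (h0 : a₀ ≠ 0) (h1 : a₁ ≠ 0) (ha0 : a₀ = c - (1 - t) * R) (ha1 : a₁ = c + t * R)
    (hb0 : b₀ = α + y + a₀ * κ) (hb1 : b₁ = β - y - N - a₁ * κ)
    (hN : 2 * N = c + 1 + α + β)
    (hd0 : a₀ * e₀ = b₀ * (b₀ - α)) (hd1 : a₁ * e₁ = b₁ * (b₁ - β))
    (hs : e₀ - e₁ + R * κ ^ 2 = 0) :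
    -(R * κ) - c * ((-(1 / t) * (κ * b₀ - e₀) + 1 / (1 - t) * (κ * b₁ + e₁))
        - κ * (y / t + (y + N) / (1 - t) - R)) =
      -((α + y) * y * a₁ / (t * a₀)) + (β - y - N) * (y + N) * a₀ / ((1 - t) * a₁) := by
  have he0 : e₀ = (α + y) * y / a₀ + (α + 2 * y) * κ + a₀ * κ ^ 2 := by
    apply mul_left_cancel₀ h0
    rw [hd0, hb0]; field_simp; ring
  have he1 : e₁ = -((β - y - N) * (y + N) / a₁) - (β - 2 * (y + N)) * κ + a₁ * κ ^ 2 := by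
    apply mul_left_cancel₀ h1
    rw [hd1, hb1]; field_simp; ring
  set E0 := (α + y) * y / a₀ with hE0
  set E1 := (β - y - N) * (y + N) / a₁ with hE1
  -- The constraint determines `κ` rationally in terms of `y` and `R`.
  have hκ : E0 + E1 = (c + 1) * κ := by
    rw [he0, he1] at hs
    linear_combination hs + κ * hN - κ ^ 2 * (ha0 - ha1)
  have r0 : (α + y) * y * a₁ / (t * a₀) = E0 * (a₁ / t) := by rw [hE0]; field_simp
  have r1 : (β - y - N) * (y + N) * a₀ / ((1 - t) * a₁) = E1 * (a₀ / (1 - t)) := by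
    rw [hE1]; field_simp
  rw [r0, r1, he0, he1, hb0, hb1, ha0, ha1]
  field_simp
  linear_combination (R * t * (1 - t)) * hκ

/-- The Painlevé equation from the first-order system for `(W, y)`. -/
lemma painleveVIAt_of_system {α β N c t : ℝ} {W y : ℝ → ℝ} (hN : 2 * N = c + 1 + α + β)
    (ht : t ∈ Ioo (0 : ℝ) 1) (h0 : W t ≠ 0) (h1 : W t ≠ 1) (h2 : W t ≠ t)
    (hW : ∀ᶠ s in nhds t, HasDerivAt W
      (1 - (s - W s) * (α + 1 + 2 * y s - s + c * W s) / (s * (1 - s))) s)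
    (hy : HasDerivAt y (-((α + y t) * y t * (1 - W t) / ((1 - t) * W t))
      + (β - y t - N) * (y t + N) * W t / (t * (1 - W t))) t) :
    PainleveVIAt (c ^ 2 / 2) (-α ^ 2 / 2) (β ^ 2 / 2) (1 / 2) W t := by
  have t0 : t ≠ 0 := ht.1.ne'
  have t1 : t - 1 ≠ 0 := by linarith [ht.2]
  have t1' : 1 - t ≠ 0 := by linarith [ht.2]
  have w1 : W t - 1 ≠ 0 := sub_ne_zero.2 h1
  have w1' : 1 - W t ≠ 0 := sub_ne_zero.2 (Ne.symm h1)
  have w2 : W t - t ≠ 0 := sub_ne_zero.2 h2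
  refine ⟨⟨t0, fun h => t1 (by rw [h]; ring), h0, h1, h2⟩, ?_⟩
  have d1 := hW.self_of_nhds
  set D := 1 - (t - W t) * (α + 1 + 2 * y t - t + c * W t) / (t * (1 - t)) with hD
  set Y := -((α + y t) * y t * (1 - W t) / ((1 - t) * W t))
      + (β - y t - N) * (y t + N) * W t / (t * (1 - W t)) with hY
  have dd : deriv W =ᶠ[nhds t] fun s =>
      1 - (s - W s) * (α + 1 + 2 * y s - s + c * W s) / (s * (1 - s)) := by
    filter_upwards [hW] with s hs using hs.deriv
  have d2 : HasDerivAt (fun s =>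
      1 - (s - W s) * (α + 1 + 2 * y s - s + c * W s) / (s * (1 - s)))
      (-((((1 - D) * (α + 1 + 2 * y t - t + c * W t)
        + (t - W t) * (2 * Y - 1 + c * D)) * (t * (1 - t))
        - (t - W t) * (α + 1 + 2 * y t - t + c * W t) * (1 * (1 - t) + t * (-1)))
          / (t * (1 - t)) ^ 2)) t := by
    have n1 := (hasDerivAt_id t).sub d1
    have n2 := (((hy.const_mul 2).const_add (α + 1)).sub (hasDerivAt_id t)).add (d1.const_mul c)
    have n3 := (hasDerivAt_id t).mul ((hasDerivAt_id t).const_sub 1)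
    exact ((n1.mul n2).div n3 (mul_ne_zero t0 t1')).const_sub 1
  rw [dd.deriv_eq, d2.deriv, d1.deriv, hD, hY]
  obtain rfl : N = (c + 1 + α + β) / 2 := by linarith
  generalize W t = w at *
  generalize y t = z at *
  clear_value D Y
  clear d2 d1 dd hD hY hy hW
  rw [show 1 - w = -(w - 1) by ring, show 1 - t = -(t - 1) by ring]
  field_simp
  ring

/-! ### The first-order system -/

/-- `R = ω P_n(t)² / h_n`, where `ω = B t^α (1-t)^β` is the height of the jump of the weight. Up to
sign it is the residue at `t` of the coefficient of `P_{n+1}` when the derivative of `P_n` is written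
as a combination of `P_n` and `P_{n+1}` with rational coefficients. -/
noncomputable def jumpResidue (α β A B : ℝ) (n : ℕ) (t : ℝ) : ℝ :=
  B * jacobiWeight α β t * (orthoPoly α β A B t n).eval t ^ 2 / normSq α β A B n t

variable {α β A B : ℝ}

lemma auxX_eq_functionalOne (n : ℕ) (t : ℝ) : auxX α β A B n t =
    β * functionalOne α β A B t (orthoPoly α β A B t n ^ 2) / normSq α β A B n t := by
  unfold auxX functionalOne
  simp only [Polynomial.eval_pow]
  ring

lemma IsAdmissible.auxX_eq {t : ℝ} (h : IsAdmissible α β A B t) (n : ℕ) :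
    auxX α β A B n t = (2 * n + 1 + α + β) + t * jumpResidue α β A B n t := by
  have hh : normSq α β A B n t ≠ 0 := (h.normSq_pos n).ne'
  have h1 : (2 * n + 1 + α + β) * normSq α β A B n t
      - β * functionalOne α β A B t (orthoPoly α β A B t n ^ 2)
      + t * (B * jacobiWeight α β t * (orthoPoly α β A B t n).eval t ^ 2) = 0 :=
    h.isPearson.parts_X_mul_sq h.isMonicOrtho n
  rw [auxX_eq_functionalOne, jumpResidue]
  field_simp
  linarith

lemma IsAdmissible.add_jumpResidue_pos {t : ℝ} (h : IsAdmissible α β A B t) (n : ℕ) :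
    0 < (2 * n + 1 + α + β) + t * jumpResidue α β A B n t := by
  rw [← h.auxX_eq, auxX_eq_functionalOne]
  exact div_pos (mul_pos h.pos_right ((h.normSq_pos n).trans_le
    (functional_sq_le_functionalOne h.pos_left h.pos_right h.nonneg h.nonneg_add _)))
    (h.normSq_pos n)

lemma IsAdmissible.sub_jumpResidue_eq {t : ℝ} (h : IsAdmissible α β A B t) (n : ℕ) :
    (2 * n + 1 + α + β) - (1 - t) * jumpResidue α β A B n t =
      α * functionalZero α β A B t (orthoPoly α β A B t n ^ 2) / normSq α β A B n t := by
  have hh : normSq α β A B n t ≠ 0 := (h.normSq_pos n).ne'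
  have h1 : (2 * n + 1 + α + β) * normSq α β A B n t
      - β * functionalOne α β A B t (orthoPoly α β A B t n ^ 2)
      + t * (B * jacobiWeight α β t * (orthoPoly α β A B t n).eval t ^ 2) = 0 :=
    h.isPearson.parts_X_mul_sq h.isMonicOrtho n
  have h2 : α * functionalZero α β A B t (orthoPoly α β A B t n ^ 2)
      - β * functionalOne α β A B t (orthoPoly α β A B t n ^ 2)
      + B * jacobiWeight α β t * (orthoPoly α β A B t n).eval t ^ 2 = 0 :=
    h.isPearson.parts_sq h.isMonicOrtho n
  rw [jumpResidue]
  field_simp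
  linarith

lemma IsAdmissible.sub_jumpResidue_pos {t : ℝ} (h : IsAdmissible α β A B t) (n : ℕ) :
    0 < (2 * n + 1 + α + β) - (1 - t) * jumpResidue α β A B n t := by
  rw [h.sub_jumpResidue_eq]
  exact div_pos (mul_pos h.pos_left ((h.normSq_pos n).trans_le
    (functional_sq_le_functionalZero h.pos_left h.pos_right h.nonneg h.nonneg_add _)))
    (h.normSq_pos n)

lemma isContDiffFamily_orthoPoly (h : ∀ s ∈ Ioo (0 : ℝ) 1, IsAdmissible α β A B s)
    (hα : 0 < α) (hβ : 0 < β) (n : ℕ) :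
    IsContDiffFamily 2 (Ioo 0 1) (fun s => orthoPoly α β A B s n) :=
  IsContDiffFamily.orthoPoly hα hβ (fun _ => contDiffOn_functional_const hα hβ A B _)
    (fun n s hs => ((h s hs).normSq_pos n).ne') n

/-- The linear system satisfied at the moving singularity by `u = P_n(t;t)`, `v = P_{n+1}(t;t)`
and by the subleading coefficient `σ` of `P_{n+1}`, together with the algebraic relations between
its coefficients: `b₀, e₀` and `b₁, e₁` are entries of the residues at `0` and `1` of the ladder
system for `(P_n, P_{n+1})`, both of rank one. -/
lemma exists_ladder (h : ∀ s ∈ Ioo (0 : ℝ) 1, IsAdmissible α β A B s) (n : ℕ) {t : ℝ}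
    (ht : t ∈ Ioo (0 : ℝ) 1) {a₀ a₁ R ω u v H : ℝ}
    (hω : ω = B * jacobiWeight α β t) (hH : H = normSq α β A B n t)
    (hu : u = (orthoPoly α β A B t n).eval t) (hv : v = (orthoPoly α β A B t (n + 1)).eval t)
    (hR : R = jumpResidue α β A B n t)
    (ha₀ : a₀ = (2 * n + 1 + α + β) - (1 - t) * R) (ha₁ : a₁ = (2 * n + 1 + α + β) + t * R) :
    ∃ b₀ b₁ e₀ e₁ : ℝ,
      a₀ * e₀ = b₀ * (b₀ - α) ∧ a₁ * e₁ = b₁ * (b₁ - β) ∧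
      e₀ - e₁ + ω * v ^ 2 / H = 0 ∧ b₀ + b₁ + ω * u * v / H = -(n + 1) ∧
      (orthoPoly α β A B t (n + 1)).coeff n = b₁ + t * (ω * u * v / H) ∧
      HasDerivAt (normSq α β A B n) (-(ω * u ^ 2)) t ∧
      HasDerivAt (fun s => (orthoPoly α β A B s n).eval s)
        (-(1 / t) * (a₀ * v - b₀ * u + α * u)
          + 1 / (1 - t) * (β * u - a₁ * v - b₁ * u) - R * u) t ∧
      HasDerivAt (fun s => (orthoPoly α β A B s (n + 1)).eval s)
        (-(1 / t) * (v * b₀ - u * e₀) + 1 / (1 - t) * (v * b₁ + u * e₁)) t ∧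
      HasDerivAt (fun s => (orthoPoly α β A B s (n + 1)).coeff n) (ω * u * v / H) t := by
  have ha := h t ht
  have hH0 : H ≠ 0 := by rw [hH]; exact (ha.normSq_pos n).ne'
  have t0 : t ≠ 0 := ht.1.ne'
  have t1 : 1 - t ≠ 0 := by linarith [ht.2]
  have J := ha.isPearson
  have M := ha.isMonicOrtho
  obtain ⟨p', hp'⟩ := (isContDiffFamily_orthoPoly h ha.pos_left ha.pos_right
    n).exists_hasPolyDerivAt two_ne_zero (Ioo_mem_nhds ht.1 ht.2)
  obtain ⟨q', hq'⟩ := (isContDiffFamily_orthoPoly h ha.pos_left ha.pos_right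
    (n + 1)).exists_hasPolyDerivAt two_ne_zero (Ioo_mem_nhds ht.1 ht.2)
  have k0 := J.det_zero M n
  have k1 := J.det_one M n
  have k2 := J.parts_sq M (n + 1)
  have k3 := J.parts_mul M n
  have k4 := J.parts_X_mul_mul M n
  have k5 := J.eval_derivative_add_self M n t0 t1
  have k6 := J.eval_derivative_add_succ M n t0 t1
  have d5 := eval_timeDeriv ht h hp' t
  have d6 := eval_timeDeriv_succ ht h hq' t
  have d7 := coeff_timeDeriv_succ ht h hq'
  have r0 := ha.sub_jumpResidue_eq n
  have r1 := (ha.auxX_eq n).symm.trans (auxX_eq_functionalOne n t)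
  have rR : R = ω * u ^ 2 / H := by rw [hR, jumpResidue, hω, hu, hH]
  rw [← hR, ← ha₀] at r0
  rw [← hR, ← ha₁] at r1
  generalize hK : (cdKernel (functionalHom ha.pos_left ha.pos_right A B t)
        (orthoPoly α β A B t) n t).eval t = K at k5 k6 d5 d6
  have eL : ∀ f, functionalHom ha.pos_left ha.pos_right A B t f = functional α β A B t f :=
    fun _ => rfl
  have eZ : ∀ f, functionalZeroHom ha.pos_left ha.pos_right A B t f =
    functionalZero α β A B t f := fun _ => rfl
  have eO : ∀ f, functionalOneHom ha.pos_left ha.pos_right A B t f =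
    functionalOne α β A B t f := fun _ => rfl
  have eN : functional α β A B t (orthoPoly α β A B t n ^ 2) = H := hH.symm
  simp only [eL, eZ, eO, eN, ← hu, ← hv, ← hω, ← hH] at k0 k1 k2 k3 k4 k5 k6 d5 d6 d7 r0 r1
  -- From here on only the values of the integrals and evaluations matter, not their origin.
  generalize functionalZero α β A B t (orthoPoly α β A B t n ^ 2) = Z0 at k0 k5 r0
  generalize functionalZero α β A B t (orthoPoly α β A B t (n + 1) ^ 2) = Z2 at k0 k2 k6
  generalize functionalZero α β A B t
    (orthoPoly α β A B t n * orthoPoly α β A B t (n + 1)) = Z1 at k0 k3 k5 k6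
  generalize functionalOne α β A B t (orthoPoly α β A B t n ^ 2) = O0 at k1 k5 r1
  generalize functionalOne α β A B t (orthoPoly α β A B t (n + 1) ^ 2) = O2 at k1 k2 k6
  generalize functionalOne α β A B t
    (orthoPoly α β A B t n * orthoPoly α β A B t (n + 1)) = O1 at k1 k3 k4 k5 k6
  refine ⟨α * Z1 / H, -(β * O1 / H), α * Z2 / H, β * O2 / H, ?_, ?_, ?_, ?_, ?_, ?_, ?_, ?_, ?_⟩
  · rw [r0]; field_simp; linear_combination k0
  · rw [r1]; field_simp; linear_combination k1
  · field_simp; linear_combination k2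
  · field_simp; linear_combination k3
  · field_simp; linear_combination k4
  · have := hasDerivAt_normSq ht h hp'
    rwa [← hω, ← hu] at this
  · refine hp'.eval_self.congr_deriv ?_
    rw [d5, r0, r1, rR]
    linear_combination k5
  · refine hq'.eval_self.congr_deriv ?_
    rw [d6]
    linear_combination k6
  · refine (hq'.coeff n).congr_deriv ?_
    rw [d7]; ring

/-- The second variable of the first-order system, besides `R`. In terms of the ladder
coefficients it equals `b₀ - α - a₀ P_{n+1}(t)/P_n(t)`; it is meaningful where
`P_n(t;t) ≠ 0`. -/
noncomputable def momentum (α β A B : ℝ) (n : ℕ) (t : ℝ) : ℝ :=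
  -(n + 1 + α) - (orthoPoly α β A B t (n + 1)).coeff n -
    (2 * n + 1 + α + β) * ((orthoPoly α β A B t (n + 1)).eval t / (orthoPoly α β A B t n).eval t)

/-- The closed first-order system for the residue `R` and the momentum. -/
lemma hasDerivAt_system (h : ∀ s ∈ Ioo (0 : ℝ) 1, IsAdmissible α β A B s) (n : ℕ) {t : ℝ}
    (ht : t ∈ Ioo (0 : ℝ) 1) (hu0 : (orthoPoly α β A B t n).eval t ≠ 0) {a₀ a₁ R y : ℝ}
    (hR : R = jumpResidue α β A B n t) (hy : y = momentum α β A B n t)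
    (ha₀ : a₀ = (2 * n + 1 + α + β) - (1 - t) * R) (ha₁ : a₁ = (2 * n + 1 + α + β) + t * R) :
    HasDerivAt (jumpResidue α β A B n) (R * (α / t - β / (1 - t) + 2 * y / t
      + 2 * (y + (n + 1 + α + β)) / (1 - t) - R)) t ∧
    HasDerivAt (momentum α β A B n) (-((α + y) * y * a₁ / (t * a₀))
      + (β - y - (n + 1 + α + β)) * (y + (n + 1 + α + β)) * a₀ / ((1 - t) * a₁)) t := by
  have ha := h t ht
  have t0 : t ≠ 0 := ht.1.ne'
  have t1 : 1 - t ≠ 0 := by linarith [ht.2]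
  have p0 : a₀ ≠ 0 := by rw [ha₀, hR]; exact (ha.sub_jumpResidue_pos n).ne'
  have p1 : a₁ ≠ 0 := by rw [ha₁, hR]; exact (ha.add_jumpResidue_pos n).ne'
  have hH0 : normSq α β A B n t ≠ 0 := (ha.normSq_pos n).ne'
  obtain ⟨b₀, b₁, e₀, e₁, k0, k1, k2, k3, k4, dH, du, dv, dσ⟩ :=
    exists_ladder h n ht rfl rfl rfl rfl hR ha₀ ha₁
  have dω := (hasDerivAt_jacobiWeight α β ht).const_mul B
  have rR : R = B * jacobiWeight α β t * (orthoPoly α β A B t n).eval t ^ 2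
    / normSq α β A B n t := by rw [hR, jumpResidue]
  set u := (orthoPoly α β A B t n).eval t with hu
  set v := (orthoPoly α β A B t (n + 1)).eval t with hv
  set κ := v / u with hκ
  set ω := B * jacobiWeight α β t with hω
  set H := normSq α β A B n t with hH
  have hvu : v = κ * u := by rw [hκ, div_mul_cancel₀ _ hu0]
  have er : ω * u * v / H = R * κ := by rw [rR, hvu]; ring
  have ee : ω * v ^ 2 / H = R * κ ^ 2 := by rw [rR, hvu]; ring
  have hy' : y = -(n + 1 + α) - (orthoPoly α β A B t (n + 1)).coeff n
    - (2 * n + 1 + α + β) * κ := hy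
  rw [er] at k3 k4 dσ
  rw [ee] at k2
  have hb₁ : b₁ = β - y - (n + 1 + α + β) - a₁ * κ := by
    rw [hy', k4, ha₁]; ring
  have hb₀ : b₀ = α + y + a₀ * κ := by
    rw [hb₁, ha₁] at k3; rw [ha₀]; linear_combination k3
  have du' : HasDerivAt (fun s => (orthoPoly α β A B s n).eval s)
      (u * (y / t + (y + (n + 1 + α + β)) / (1 - t) - R)) t := by
    refine du.congr_deriv ?_
    rw [hb₀, hb₁, hvu]; field_simp; ring
  constructor
  · refine ((dω.mul (du'.pow 2)).div dH hH0).congr_deriv ?_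
    simp only [Pi.mul_apply, Pi.pow_apply, ← hu, ← hω, ← hH]
    rw [rR]
    field_simp
    ring
  · refine (((dσ.const_sub (-(n + 1 + α))).sub
      ((dv.div du' hu0).const_mul (2 * n + 1 + α + β))).congr_deriv ?_)
    rw [← momentum_identity t0 t1 p0 p1 ha₀ ha₁ hb₀ hb₁ (by ring) k0 k1 k2]
    simp only [← hu, ← hv]
    rw [hvu]
    field_simp

/-! ### Regularity and the Painlevé equation -/

lemma isAdmissible_of_mem_Ioo (hα : 0 < α) (hβ : 0 < β) (hA : 0 ≤ A) (hAB : 0 ≤ A + B)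
    (hne : 0 < A ∨ 0 < A + B) : ∀ s ∈ Ioo (0 : ℝ) 1, IsAdmissible α β A B s := fun _ hs =>
  ⟨hα, hβ, hA, hAB, ⟨hs.1.le, hs.2⟩, hne.imp_left fun h => ⟨h, hs.1⟩⟩

lemma jumpResidue_eq_zero_iff {t : ℝ} (h : IsAdmissible α β A B t) (ht : 0 < t) (n : ℕ) :
    jumpResidue α β A B n t = 0 ↔ B * (orthoPoly α β A B t n).eval t = 0 := by
  have h1 : jacobiWeight α β t ≠ 0 := (jacobiWeight_pos ⟨ht, h.mem.2⟩).ne'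
  simp [jumpResidue, (h.normSq_pos n).ne', h1]

lemma contDiffOn_jumpResidue (h : ∀ s ∈ Ioo (0 : ℝ) 1, IsAdmissible α β A B s)
    (hα : 0 < α) (hβ : 0 < β) (n : ℕ) :
    ContDiffOn ℝ 2 (jumpResidue α β A B n) (Ioo 0 1) := by
  have hP := isContDiffFamily_orthoPoly h hα hβ n
  have hN := (hP.mul hP).functional hα hβ (fun _ => contDiffOn_functional_const hα hβ A B _)
  simp only [← sq] at hN
  exact ((contDiffOn_const.mul (contDiffOn_jacobiWeight α β 2)).mul (hP.eval_self.pow 2)).div hN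
    fun s hs => ((h s hs).normSq_pos n).ne'

/-- If the weight does not vanish identically at `t = 0`, then `R` is continuous up to `0`. -/
lemma continuousOn_jumpResidue (h : ∀ s ∈ Ico (0 : ℝ) 1, IsAdmissible α β A B s)
    (hα : 0 < α) (hβ : 0 < β) (n : ℕ) :
    ContinuousOn (jumpResidue α β A B n) (Ico 0 1) := by
  have hm : ∀ j : ℕ, ContDiffOn ℝ 0 (fun s => functional α β A B s (Polynomial.X ^ j))
      (Ico 0 1) := fun j => contDiffOn_zero.2
    ((continuousOn_functional_const hα hβ A B _).mono Ico_subset_Icc_self)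
  have hP : IsContDiffFamily 0 (Ico 0 1) (fun s => orthoPoly α β A B s n) :=
    IsContDiffFamily.orthoPoly hα hβ hm (fun n s hs => ((h s hs).normSq_pos n).ne') n
  have hN := (hP.mul hP).functional hα hβ hm
  simp only [← sq] at hN
  exact ((continuousOn_const.mul (continuous_jacobiWeight hα hβ).continuousOn).mul
    (hP.eval_self.continuousOn.pow 2)).div hN.continuousOn
    fun s hs => ((h s hs).normSq_pos n).ne'

end PerturbedJacobi

open PerturbedJacobi in
theorem mainTheorem3 (α β A B : ℝ) (hα : 0 < α) (hβ : 0 < β)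
    (hA : 0 ≤ A) (hAB : 0 ≤ A + B) (hne : 0 < A ∨ 0 < A + B) (n : ℕ)
    (W : ℝ → ℝ)
    (hW : ∀ t ∈ Ico (0 : ℝ) 1,
      PerturbedJacobi.auxX α β A B n t =
        (2 * (n : ℝ) + 1 + α + β) * (1 - W t) / (1 - t)) :
    ContDiffOn ℝ 2 W (Ioo 0 1) ∧
    (∀ t ∈ Ioo (0 : ℝ) 1,
      (W t = t ↔ B * (PerturbedJacobi.orthoPoly α β A B t n).eval t = 0) ∧
      (W t ≠ t →
        PerturbedJacobi.PainleveVIAt ((2 * (n : ℝ) + α + β + 1) ^ 2 / 2) (-α ^ 2 / 2)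
          (β ^ 2 / 2) (1 / 2) W t)) ∧
    (0 < A + B → W 0 = 0 ∧ HasDerivWithinAt W 1 (Ici 0) 0) := by
  have hadm := isAdmissible_of_mem_Ioo hα hβ hA hAB hne
  set c : ℝ := 2 * (n : ℝ) + 1 + α + β with hc
  have hcpos : 0 < c := by positivity
  have hc0 : c ≠ 0 := hcpos.ne'
  set R := jumpResidue α β A B n with hR
  have hWR : ∀ t, IsAdmissible α β A B t → W t = t - t * (1 - t) * R t / c := by
    intro t h
    have h1 := hW t h.mem
    have t1 : 1 - t ≠ 0 := by linarith [h.mem.2]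
    rw [h.auxX_eq, ← hc, ← hR, eq_div_iff t1] at h1
    field_simp
    linear_combination h1
  have hW' : ∀ t ∈ Ioo (0 : ℝ) 1, W t = t - t * (1 - t) * R t / c := fun t ht =>
    hWR t (hadm t ht)
  have hWt : ∀ t ∈ Ioo (0 : ℝ) 1, (W t = t ↔ R t = 0) := by
    intro t ht
    have t0 : t ≠ 0 := ht.1.ne'
    have t1 : 1 - t ≠ 0 := by linarith [ht.2]
    rw [hW' t ht, sub_eq_self]
    simp [t0, t1, hc0]
  have hRd : ContDiffOn ℝ 2 R (Ioo 0 1) := contDiffOn_jumpResidue hadm hα hβ n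
  refine ⟨?_, fun t ht => ⟨(hWt t ht).trans (jumpResidue_eq_zero_iff (hadm t ht) ht.1 n),
    fun hne' => ?_⟩, fun hpos => ?_⟩
  · exact (contDiffOn_id.sub (((contDiffOn_id.mul (contDiffOn_const.sub contDiffOn_id)).mul
      hRd).div_const c)).congr hW'
  · have hW0 : ∀ s ∈ Ioo (0 : ℝ) 1, s * (c - (1 - s) * R s) = c * W s := by
      intro s hs; rw [hW' s hs]; field_simp
    have hW1 : ∀ s ∈ Ioo (0 : ℝ) 1, (1 - s) * (c + s * R s) = c * (1 - W s) := by
      intro s hs; rw [hW' s hs]; field_simp; ring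
    have p0 := (hadm t ht).sub_jumpResidue_pos n
    have p1 := (hadm t ht).add_jumpResidue_pos n
    rw [← hc, ← hR] at p0 p1
    have t0 : 0 < t := ht.1
    have t1 : 0 < 1 - t := by linarith [ht.2]
    have w0 : W t ≠ 0 := fun hw => by
      have h1 := hW0 t ht
      rw [hw, mul_zero] at h1
      exact (mul_pos t0 p0).ne' h1
    have w1 : 1 - W t ≠ 0 := fun hw => by
      have h1 := hW1 t ht
      rw [hw, mul_zero] at h1
      exact (mul_pos t1 p1).ne' h1
    have hRne : R t ≠ 0 := fun h => hne' ((hWt t ht).2 h)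
    have hu : ∀ s, R s ≠ 0 → (orthoPoly α β A B s n).eval s ≠ 0 := by
      intro s hs hu
      apply hs
      simp [hR, jumpResidue, hu]
    have hev : ∀ᶠ s in nhds t, s ∈ Ioo (0 : ℝ) 1 ∧ R s ≠ 0 :=
      Filter.Eventually.and (Ioo_mem_nhds ht.1 ht.2)
        ((hRd.continuousOn.continuousAt (Ioo_mem_nhds ht.1 ht.2)).eventually_ne hRne)
    rw [show 2 * (n : ℝ) + α + β + 1 = c by rw [hc]; ring]
    refine painleveVIAt_of_system (N := n + 1 + α + β) (y := momentum α β A B n)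
      (by rw [hc]; ring) ht w0 (fun h => w1 (by rw [h]; ring)) hne' ?_ ?_
    · filter_upwards [hev] with s hs
      have s0 : s ≠ 0 := hs.1.1.ne'
      have s1 : 1 - s ≠ 0 := by linarith [hs.1.2]
      have dR := (hasDerivAt_system hadm n hs.1 (hu s hs.2) rfl rfl rfl rfl).1
      rw [← hR] at dR
      have dW := (hasDerivAt_id s).sub ((((hasDerivAt_id s).mul
        ((hasDerivAt_id s).const_sub 1)).mul dR).div_const c)
      refine (dW.congr_of_eventuallyEq ?_).congr_deriv ?_
      · filter_upwards [Ioo_mem_nhds hs.1.1 hs.1.2] with r hr using hW' r hr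
      · rw [hW' s hs.1]
        simp only [id, Pi.mul_apply]
        generalize momentum α β A B n s = y
        generalize R s = r
        field_simp
        rw [hc]
        ring
    · refine (hasDerivAt_system hadm n ht (hu t hRne) rfl rfl rfl rfl).2.congr_deriv ?_
      rw [← hc, ← hR]
      have e0 : W t = t * (c - (1 - t) * R t) / c := by
        rw [hW0 t ht]; field_simp
      have e1 : 1 - W t = (1 - t) * (c + t * R t) / c := by
        rw [hW1 t ht]; field_simp
      rw [e1, e0]
      generalize momentum α β A B n t = y
      have t0' := t0.ne'
      have t1' := t1.ne'
      have p0' := p0.ne'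
      have p1' := p1.ne'
      field_simp
  · have hadm0 : ∀ s ∈ Ico (0 : ℝ) 1, IsAdmissible α β A B s := fun s hs =>
      ⟨hα, hβ, hA, hAB, hs, Or.inr hpos⟩
    have hz : (0 : ℝ) ∈ Ico (0 : ℝ) 1 := ⟨le_rfl, one_pos⟩
    have h0 : W 0 = 0 := by rw [hWR 0 (hadm0 0 hz)]; simp
    have hR0 : R 0 = 0 := by simp [hR, jumpResidue, jacobiWeight_zero hα]
    refine ⟨h0, ?_⟩
    have hIco : Ico (0 : ℝ) 1 ∈ nhdsWithin 0 (Ici 0) := Ico_mem_nhdsGE one_pos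
    have hcont : ContinuousWithinAt R (Ici 0) 0 :=
      (continuousOn_jumpResidue hadm0 hα hβ n 0 hz).mono_of_mem_nhdsWithin hIco
    -- The difference quotient of `W` at `0` is `1 - (1 - s) R(s) / c`.
    rw [hasDerivWithinAt_iff_tendsto_slope]
    have hlim : Filter.Tendsto (fun s => 1 - (1 - s) * R s / c) (nhdsWithin 0 (Ici 0 \ {0}))
        (nhds 1) := by
      have : ContinuousWithinAt (fun s => 1 - (1 - s) * R s / c) (Ici 0) 0 :=
        continuousWithinAt_const.sub (((continuousWithinAt_const.sub
          continuousWithinAt_id).mul hcont).div_const c)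
      have h1 := this.mono (sdiff_subset : Ici (0 : ℝ) \ {0} ⊆ Ici 0)
      simpa [ContinuousWithinAt, hR0] using h1
    refine hlim.congr' ?_
    filter_upwards [nhdsWithin_mono 0 (sdiff_subset : Ici (0 : ℝ) \ {0} ⊆ Ici 0) hIco,
      self_mem_nhdsWithin] with s hs hs'
    have s0 : s ≠ 0 := hs'.2
    rw [slope_def_field, h0, hWR s (hadm0 s hs)]
    field_simp
    ring
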